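/- All graphs are finite and simple. Let $r\ge 2$ be an integer and let $G$ be a connected graph with vertex set $\{v_1,\dots,v_n\}$, $n\ge r-1$, numbered so that $\deg(v_1)\ge\deg(v_2)\ge\cdots\ge\deg(v_n)$. The odd girth of $G$ is the length of a shortest odd cycle of $G$, and it is $\infty$ if $G$ is bipartite. The graph $\mathrm{KG}(G,rK_2)$ has as vertices all subgraphs of $G$ isomorphic to $rK_2$ (the disjoint union of $r$ edges), that is, all matchings of size $r$ in $G$; two of them are adjacent if they have no edge in common. Let $g\in\mathbb{N}\cup\{\infty\}$ and suppose that 1. the odd girth of $G$ is at least $g$; 2. $r\le\max\left\{\frac g2,\ \frac{\deg(v_{r-1})+1}{4}\right\}$; 3. $\{v_1,\dots,v_{r-1}\}$ is an independent set of $G$; 4. $\deg(v_{r-1})$ is even, or $n\ge r$ and $\deg(v_{r-1})>\deg(v_r)$. Then $$\chi\bigl(\mathrm{KG}(G,rK_2)\bigr)=|E(G)|-\sum_{i=1}^{r-1}\deg(v_i),$$ where the chromatic number of a graph without vertices is $0$. -/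

import Mathlib

open scoped ENNReal

/-- The odd girth of `G`: the length of a shortest odd cycle, and `⊤` if there is no odd cycle
(that is, if `G` is bipartite). -/
noncomputable def SimpleGraph.oddGirth {V : Type*} (G : SimpleGraph V) : ℕ∞ :=
  ⨅ (a : V) (w : G.Walk a a) (_ : w.IsCycle) (_ : Odd w.length), (w.length : ℕ∞)

/-- The graph `rK₂`: the disjoint union of `r` edges, the `i`-th edge joining `(i, 0)` and
`(i, 1)`. -/
def matchingGraph (r : ℕ) : SimpleGraph (Fin r × Fin 2) where
  Adj x y := x.1 = y.1 ∧ x.2 ≠ y.2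
  symm := ⟨fun _ _ h => ⟨h.1.symm, h.2.symm⟩⟩
  loopless := ⟨fun _ h => h.2 rfl⟩

/-- The general Kneser graph `KG(G, F)`: its vertices are the subgraphs of `G` that are isomorphic
to `F`, and two distinct ones are adjacent when they are edge-disjoint. (If `F` has an edge,
edge-disjoint copies of `F` are automatically distinct.) -/
def generalKneserGraph {V W : Type*} (G : SimpleGraph V) (F : SimpleGraph W) :
    SimpleGraph {K : G.Subgraph // Nonempty (K.coe ≃g F)} where
  Adj A B := A ≠ B ∧ Disjoint A.1.edgeSet B.1.edgeSet
  symm := ⟨fun _ _ h => ⟨h.1.symm, h.2.symm⟩⟩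
  loopless := ⟨fun _ h => h.1 rfl⟩

/-! Let `A` consist of the `r - 1` vertices of largest degree. For the upper bound, `r - 1` vertices
cannot meet `r` disjoint edges, so every `r`-matching has an edge avoiding `A`, and that edge serves
as its colour. Since `A` is independent, exactly `|E| - ∑ v ∈ A, deg v` edges avoid it.

The lower bound is topological. Order the edges and consider sign vectors on them. By
`le_add_of_altSeq`, a consequence of the octahedral Tucker lemma, it suffices that every sign vector
with an alternating subsequence longer than `∑ v ∈ A, deg v` contains an `r`-matching inside one
sign class. The order follows an Euler tour (`Connected.exists_edge_order_of_odd`,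
`Connected.exists_edge_order_of_even`). The even-numbered terms of an alternating subsequence then
occupy no two consecutive positions, nor do the odd-numbered ones, so each of these two classes
takes about half of the edges at every vertex.

A class without an `r`-matching has a set `S` of at most `r - 1` vertices that meets all but `(r - 1
- |S|) * h` of its edges, where `h = D / 2` and `D` is the smallest degree in `A`
(`exists_cover_of_matchings_le`). This is a Gallai-type argument: what remains is small, or, for odd
girth at least `2r`, bipartite and then empty. By the parity condition `h` separates the half
degrees inside `A` from those outside, so `sum_weights_le` bounds the two classes together by `∑ v ∈
A, deg v`, a contradiction.

If all degrees are even, the order is cyclic and the subsequence must be one term longer. In return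
both classes contain an `r`-matching, hence one with nonzero colour, which recovers the lost unit.
-/

/-! ### The octahedral Tucker lemma, by counting alternating chains mod 2. -/

/-- The antipode on signed labels. -/
def labelNeg (a : ℕ × Bool) : ℕ × Bool := (a.1, !a.2)

/-- The indicator (mod 2) of a list of signed labels having alternating signs, the first one
being `b`. -/
def altList : Bool → List (ℕ × Bool) → ZMod 2
  | _, [] => 1
  | b, x :: l => if x.2 = b then altList (!b) l else 0

theorem altList_map_labelNeg (b : Bool) (l : List (ℕ × Bool)) :
    altList b (l.map labelNeg) = altList (!b) l := by
  induction l generalizing b with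
  | nil => rfl
  | cons x l ih =>
    obtain ⟨n, c⟩ := x
    cases b <;> cases c <;> simp [altList, labelNeg, ih]

/-- Lexicographic order on labels. -/
def labelLE (a b : ℕ × Bool) : Prop := toLex a ≤ toLex b

instance : DecidableRel labelLE := fun a b => inferInstanceAs (Decidable (toLex a ≤ toLex b))
instance : IsTrans (ℕ × Bool) labelLE := ⟨fun _ _ _ h h' => le_trans (α := ℕ ×ₗ Bool) h h'⟩
instance : Std.Antisymm labelLE := ⟨fun _ _ h h' => le_antisymm (α := ℕ ×ₗ Bool) h h'⟩
instance : Std.Total labelLE := ⟨fun a b => le_total (α := ℕ ×ₗ Bool) a b⟩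

/-- Deleting the entries of a sorted list one by one. -/
theorem sum_altList_erase (b : Bool) (l : List (ℕ × Bool)) (hl : l.Pairwise labelLE) :
    (l.map fun a => altList b (l.erase a)).sum = altList b l + altList (!b) l := by
  induction l generalizing b with
  | nil => simp [altList]; decide
  | cons a l ih =>
    -- `List.erase` removes the first occurrence. If `c = a`, sortedness makes the head of `l` equal
    -- to `a` as well, so removing either copy gives the same list.
    have key : ∀ c ∈ l, (a :: l).erase c = a :: l.erase c := by
      intro c hc
      by_cases hac : a = c
      · subst hac
        cases l with
        | nil => simp at hc
        | cons d l =>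
          have h1 : labelLE a d := by simp at hl; exact hl.1.1
          have h2 : labelLE d a := by
            rcases List.mem_cons.1 hc with rfl | h
            · exact le_refl (α := ℕ ×ₗ Bool) _
            · exact (List.pairwise_cons.1 (List.pairwise_cons.1 hl).2).1 _ h
          have : a = d := antisymm_of labelLE h1 h2
          subst this; simp
      · rw [List.erase_cons_tail]; simpa using hac
    have e1 : (l.map fun c => altList b ((a :: l).erase c)) =
        l.map fun c => (if a.2 = b then 1 else 0) * altList (!b) (l.erase c) := by
      apply List.map_congr_left
      intro c hc
      rw [key c hc, altList]
      split_ifs <;> simp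
    rw [List.map_cons, List.sum_cons, e1, List.sum_map_mul_left, ih _ (List.pairwise_cons.1 hl).2,
      List.erase_cons_head]
    obtain ⟨n, c⟩ := a
    have two : ∀ z : ZMod 2, z + z = 0 := by decide
    cases b <;> cases c <;> simp [altList] <;> grind

/-- The alternation cochain. -/
def altCochain (b : Bool) (s : Multiset (ℕ × Bool)) : ZMod 2 := altList b (s.sort labelLE)

theorem sum_altCochain_erase (b : Bool) (s : Multiset (ℕ × Bool)) :
    (s.map fun a => altCochain b (s.erase a)).sum = altCochain b s + altCochain (!b) s := by
  have hs := Multiset.sort_eq s labelLE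
  have hp := Multiset.pairwise_sort s labelLE
  rw [altCochain, altCochain, ← sum_altList_erase b _ hp]
  conv_lhs => rw [← hs]
  rw [Multiset.map_coe, Multiset.sum_coe]
  congr 1
  apply List.map_congr_left
  intro a _
  rw [hs, altCochain]
  congr 1
  refine List.Perm.eq_of_pairwise' (r := labelLE) (Multiset.pairwise_sort _ _)
    (hp.sublist List.erase_sublist) ?_
  rw [← Multiset.coe_eq_coe, Multiset.sort_eq]
  conv_lhs => rw [← hs]
  rw [Multiset.coe_erase, lawful_beq_subsingleton instBEqOfDecidableEq instBEqProd]

/-- No two labels share a number with opposite signs, so negation preserves the sorted order. -/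
theorem altCochain_map_labelNeg (b : Bool) (s : Multiset (ℕ × Bool))
    (h : ∀ x ∈ s, ∀ y ∈ s, y ≠ labelNeg x) :
    altCochain b (s.map labelNeg) = altCochain (!b) s := by
  rw [altCochain, ← Multiset.map_sort labelNeg s labelLE labelLE, altList_map_labelNeg]; rfl
  rintro ⟨x, b⟩ hx ⟨y, c⟩ hy
  have := h _ hx _ hy
  simp only [labelLE, labelNeg, Prod.Lex.toLex_le_toLex, ne_eq, Prod.mk.injEq, not_and] at *
  by_cases hxy : y = x
  · have := this hxy
    have hbc : c = b := by cases b <;> cases c <;> simp_all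
    subst hbc hxy; simp
  · have : x ≠ y := fun h => hxy h.symm
    simp [this]

/-- Neighbours have opposite signs, so equal numbers would make them antipodal; the numbers are
therefore strictly increasing below `m`. -/
theorem card_le_of_altList_ne_zero (l : List (ℕ × Bool)) (m : ℕ) (b : Bool)
    (hl : l.Pairwise labelLE) (hm : ∀ x ∈ l, x.1 < m) (h : ∀ x ∈ l, ∀ y ∈ l, y ≠ labelNeg x)
    (h0 : altList b l ≠ 0) : l.length ≤ m := by
  have hsort : (l.map Prod.fst).Pairwise (· < ·) := by
    rw [← List.isChain_iff_pairwise, List.isChain_map]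
    clear hm
    induction l generalizing b with
    | nil => simp
    | cons x l ih =>
      cases l with
      | nil => simp
      | cons y l =>
        rw [List.isChain_cons_cons]
        rw [altList] at h0
        split_ifs at h0 with hb
        · refine ⟨?_, ih _ (List.pairwise_cons.1 hl).2 (fun x hx y hy =>
            h x (by simp [hx]) y (by simp [hy])) h0⟩
          rw [altList] at h0
          split_ifs at h0 with hb'
          have h1 : labelLE x y := by simp at hl; exact hl.1.1
          have h2 := h x (by simp) y (by simp)
          rcases Prod.Lex.toLex_le_toLex.1 h1 with h3 | h3
          · exact h3
          · exfalso; apply h2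
            ext1
            · exact h3.1.symm
            · simp [labelNeg, hb, hb']
          · exact absurd rfl h0
        · exact absurd rfl h0
  have hnd : (l.map Prod.fst).Nodup := hsort.imp (fun h => ne_of_lt h)
  have := (List.toFinset_card_of_nodup hnd).symm.le.trans
    (Finset.card_le_card (t := Finset.range m) (by
      intro x hx
      simp only [List.mem_toFinset, List.mem_map] at hx
      obtain ⟨a, ha, rfl⟩ := hx
      simpa using hm a ha))
  simpa using this

/-- The multiset of values of a tuple. -/
def tupleVals {n : ℕ} (t : Fin n → ℕ × Bool) : Multiset (ℕ × Bool) := Finset.univ.val.map t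

theorem tupleVals_succAbove {n : ℕ} (t : Fin (n + 1) → ℕ × Bool) (j : Fin (n + 1)) :
    tupleVals (fun i => t (j.succAbove i)) = (tupleVals t).erase (t j) := by
  have : (Finset.univ : Finset (Fin (n + 1))).val =
      j ::ₘ (Finset.univ.val.map j.succAbove) := by
    rw [Fin.univ_succAbove n j]; simp
  rw [tupleVals, tupleVals, this, Multiset.map_cons, Multiset.erase_cons_head, Multiset.map_map]
  rfl

theorem sum_altCochain_succAbove (b : Bool) {n : ℕ} (t : Fin (n + 1) → ℕ × Bool) :
    ∑ j : Fin (n + 1), altCochain b (tupleVals fun i => t (j.succAbove i)) =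
      altCochain b (tupleVals t) + altCochain (!b) (tupleVals t) := by
  rw [← sum_altCochain_erase]
  simp_rw [tupleVals_succAbove]
  rw [tupleVals, Multiset.map_map]
  rfl

/-- The chain of sign vectors given by an order of the coordinates and a choice of signs. -/
def chainVec {n : ℕ} (σ : Equiv.Perm (Fin n)) (ε : Fin n → Bool) (j : Fin n) : Fin n → SignType :=
  fun i => if j ≤ σ i then (if ε i then 1 else -1) else 0

theorem chainVec_ne_zero {n : ℕ} (σ : Equiv.Perm (Fin n)) (ε : Fin n → Bool) (j : Fin n) :
    chainVec σ ε j ≠ 0 := by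
  intro h
  have := congrFun h (σ.symm j)
  simp only [chainVec, Equiv.apply_symm_apply, le_refl, if_true, Pi.zero_apply] at this
  split_ifs at this

theorem chainVec_le {n : ℕ} (σ : Equiv.Perm (Fin n)) (ε : Fin n → Bool) {j k : Fin n}
    (hjk : j ≤ k) (i : Fin n) (h : chainVec σ ε k i ≠ 0) :
    chainVec σ ε j i = chainVec σ ε k i := by
  unfold chainVec at *
  by_cases h1 : k ≤ σ i
  · simp [h1, hjk.trans h1]
  · simp [h1] at h

theorem chainVec_neg {n : ℕ} (σ : Equiv.Perm (Fin n)) (ε : Fin n → Bool) (j : Fin n) :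
    chainVec σ (fun i => !ε i) j = -chainVec σ ε j := by
  funext i
  simp only [chainVec, Pi.neg_apply]
  by_cases h1 : j ≤ σ i <;> by_cases h2 : ε i = true <;> simp [h1, h2]

/-- Level `j` keeps the coordinates of rank at least `j`; exchanging ranks `k` and `k + 1` is
visible only at level `k + 1`. These are the two maximal chains through an interior facet. -/
theorem chainVec_swap_mul {n : ℕ} (σ : Equiv.Perm (Fin (n + 1))) (ε : Fin (n + 1) → Bool)
    (k : Fin n) (j : Fin (n + 1)) (hj : j ≠ k.succ) :
    chainVec (Equiv.swap k.castSucc k.succ * σ) ε j = chainVec σ ε j := by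
  funext i
  have : j ≤ (Equiv.swap k.castSucc k.succ * σ) i ↔ j ≤ σ i := by
    rw [Equiv.Perm.mul_apply]
    by_cases h1 : σ i = k.castSucc
    · rw [h1, Equiv.swap_apply_left]
      simp only [Fin.le_def, Fin.val_succ, Fin.val_castSucc, ne_eq, Fin.ext_iff] at *; omega
    by_cases h2 : σ i = k.succ
    · rw [h2, Equiv.swap_apply_right]
      simp only [Fin.le_def, Fin.val_succ, Fin.val_castSucc, ne_eq, Fin.ext_iff] at *; omega
    rw [Equiv.swap_apply_of_ne_of_ne h1 h2]
  simp only [chainVec, this]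

theorem ZMod.sum_two_involution {α : Type*} [Fintype α] (f : α → ZMod 2) (g : α → α)
    (hg : ∀ a, g (g a) = a) (hne : ∀ a, g a ≠ a) (hf : ∀ a, f (g a) = f a) : ∑ a, f a = 0 := by
  classical
  refine Finset.sum_involution (fun a _ => g a) ?_ (fun a _ _ => hne a) (by simp)
    (fun a _ => hg a)
  intro a _
  rw [hf]
  exact CharTwo.add_self_eq_zero _

/-- The number of maximal chains with positive alternating labels is odd. -/
theorem sum_altCochain_chainVec (n : ℕ) : ∀ (L : (Fin n → SignType) → ℕ × Bool)
    (_ : ∀ x, x ≠ 0 → L (-x) = labelNeg (L x))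
    (_ : ∀ x y, x ≠ 0 → (∀ i, x i ≠ 0 → y i = x i) → L y ≠ labelNeg (L x)),
    ∑ σ : Equiv.Perm (Fin n), ∑ ε : Fin n → Bool,
      altCochain true (tupleVals fun j => L (chainVec σ ε j)) = 1 := by
  induction n with
  | zero =>
    intro L _ _
    simp [tupleVals, altCochain, altList]
  | succ n ih =>
    intro L hanti hcomp
    have hneg : ∀ (σ : Equiv.Perm (Fin (n + 1))) (ε : Fin (n + 1) → Bool),
        altCochain true (tupleVals fun j => L (chainVec σ (fun i => !ε i) j)) =
          altCochain false (tupleVals fun j => L (chainVec σ ε j)) := by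
      intro σ ε
      have : (tupleVals fun j => L (chainVec σ (fun i => !ε i) j)) =
          (tupleVals fun j => L (chainVec σ ε j)).map labelNeg := by
        rw [tupleVals, tupleVals, Multiset.map_map]
        refine Multiset.map_congr rfl fun j _ => ?_
        rw [chainVec_neg, hanti _ (chainVec_ne_zero _ _ _)]; rfl
      rw [this, altCochain_map_labelNeg]
      · rfl
      · intro x hx y hy
        simp only [tupleVals, Multiset.mem_map] at hx hy
        obtain ⟨j, -, rfl⟩ := hx
        obtain ⟨k, -, rfl⟩ := hy
        rcases le_total j k with h | h
        · intro he
          refine hcomp _ _ (chainVec_ne_zero σ ε k) (chainVec_le σ ε h) ?_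
          rw [he]; simp [labelNeg]
        · exact hcomp _ _ (chainVec_ne_zero σ ε j) (chainVec_le σ ε h)
    -- The antipode folds the chains with `ε 0 = false` onto the hemisphere `ε 0 = true`. There the
    -- alternating chains of both starting signs add up to the alternating facets.
    have h1 : ∀ σ : Equiv.Perm (Fin (n + 1)), ∑ ε : Fin (n + 1) → Bool,
        altCochain true (tupleVals fun j => L (chainVec σ ε j)) =
        ∑ ε : Fin n → Bool, ∑ j : Fin (n + 1), altCochain true (tupleVals fun i =>
          L (chainVec σ (Fin.cons true ε) (j.succAbove i))) := by
      intro σ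
      rw [← (Fin.consEquiv fun _ => Bool).sum_comp, Fintype.sum_prod_type, Fintype.sum_bool]
      simp only [Fin.consEquiv, Equiv.coe_fn_mk]
      have e : ∑ ε : Fin n → Bool, altCochain true (tupleVals fun j =>
            L (chainVec σ (Fin.cons false ε) j)) =
          ∑ ε : Fin n → Bool, altCochain false (tupleVals fun j =>
            L (chainVec σ (Fin.cons true ε) j)) := by
        refine Fintype.sum_equiv (Equiv.arrowCongr (Equiv.refl _) Equiv.boolNot) _ _ fun ε => ?_
        rw [← hneg]
        refine congrArg (fun t => altCochain true (tupleVals t)) (funext fun j =>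
          congrArg L (funext fun i => ?_))
        refine Fin.cases ?_ (fun i => ?_) i <;> simp [Equiv.arrowCongr, chainVec]
      rw [e, ← Finset.sum_add_distrib]
      refine Finset.sum_congr rfl fun ε _ => ?_
      exact (sum_altCochain_succAbove true fun j => L (chainVec σ (Fin.cons true ε) j)).symm
    simp_rw [h1]
    -- Facets that keep the full-support vector lie in two chains of the hemisphere and cancel.
    have h2 : ∀ k : Fin n, ∑ σ : Equiv.Perm (Fin (n + 1)), ∑ ε : Fin n → Bool,
        altCochain true (tupleVals fun i =>
          L (chainVec σ (Fin.cons true ε) (k.succ.succAbove i))) = 0 := by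
      intro k
      refine ZMod.sum_two_involution _ (fun σ => Equiv.swap k.castSucc k.succ * σ) ?_ ?_ ?_
      · intro σ; rw [← mul_assoc, Equiv.swap_mul_self, one_mul]
      · intro σ h
        have := mul_eq_right.1 h
        rw [Equiv.Perm.one_def, Equiv.swap_eq_refl_iff] at this
        exact Fin.castSucc_lt_succ.ne this
      · intro σ
        simp_rw [chainVec_swap_mul _ _ k _ (Fin.succAbove_ne _ _)]
    -- Dropping the full-support vector leaves the coordinate of rank 0 zero throughout. If it is
    -- coordinate 0, the facet lies on the equator and induction applies; otherwise flipping its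
    -- sign pairs the facets.
    have h3 : ∑ σ : Equiv.Perm (Fin (n + 1)), ∑ ε : Fin n → Bool,
        altCochain true (tupleVals fun i =>
          L (chainVec σ (Fin.cons true ε) (Fin.succAbove 0 i))) = 1 := by
      rw [← Equiv.Perm.decomposeFin.symm.sum_comp, Fintype.sum_prod_type,
        Fintype.sum_eq_single 0]
      · rw [← ih (fun x => L (Fin.cons 0 x))]
        · refine Finset.sum_congr rfl fun σ _ => Finset.sum_congr rfl fun ε _ => ?_
          refine congrArg (fun t => altCochain true (tupleVals t)) (funext fun j =>
          congrArg L (funext fun i => ?_))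
          refine Fin.cases ?_ (fun i => ?_) i
          · simp [chainVec]
          · simp [chainVec]
        · intro x hx
          rw [← hanti]
          · congr; funext i
            refine Fin.cases ?_ (fun i => ?_) i <;> simp
          · intro h; apply hx; funext i
            simpa using congrFun h i.succ
        · intro x y hx hxy
          refine hcomp _ _ ?_ ?_
          · intro h; apply hx; funext i
            simpa using congrFun h i.succ
          · intro i
            refine Fin.cases ?_ (fun i => ?_) i
            · simp
            · simpa using hxy i
      · intro p hp
        refine Finset.sum_eq_zero fun e _ => ?_
        set σ := Equiv.Perm.decomposeFin.symm (p, e) with hσ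
        have h0 : σ 0 = p := Equiv.Perm.decomposeFin_symm_apply_zero p e
        obtain ⟨i0, hi0⟩ : ∃ i0 : Fin n, σ i0.succ = 0 := by
          have : σ.symm 0 ≠ 0 := by
            intro h; apply hp; rw [← h0, ← (Equiv.symm_apply_eq σ).1 h]
          obtain ⟨i, hi⟩ := Fin.exists_succ_eq.2 this
          exact ⟨i, by rw [hi]; simp⟩
        refine ZMod.sum_two_involution _ (fun ε => Function.update ε i0 (!ε i0)) ?_ ?_ ?_
        · intro ε; simp
        · intro ε h
          have := congrFun h i0
          simp at this
        · intro ε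
          refine congrArg (fun t => altCochain true (tupleVals t)) (funext fun j =>
          congrArg L (funext fun i => ?_))
          refine Fin.cases ?_ (fun i => ?_) i
          · simp [chainVec]
          · by_cases hi : i = i0
            · subst hi; simp [chainVec, hi0]
            · simp [chainVec, Function.update_of_ne hi]
    calc _ = ∑ j : Fin (n + 1), ∑ σ : Equiv.Perm (Fin (n + 1)), ∑ ε : Fin n → Bool,
        altCochain true (tupleVals fun i =>
          L (chainVec σ (Fin.cons true ε) (j.succAbove i))) := by
          simp_rw [Finset.sum_comm (t := (Finset.univ : Finset (Fin (n + 1))))]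
      _ = 1 := by
          rw [Fin.sum_univ_succ, h3]; simp [h2]

/-- The octahedral Tucker lemma. -/
theorem octahedral_tucker {n m : ℕ} (L : (Fin n → SignType) → ℕ × Bool)
    (hm : ∀ x, x ≠ 0 → (L x).1 < m) (hanti : ∀ x, x ≠ 0 → L (-x) = labelNeg (L x))
    (hcomp : ∀ x y, x ≠ 0 → (∀ i, x i ≠ 0 → y i = x i) → L y ≠ labelNeg (L x)) : n ≤ m := by
  have hsum := sum_altCochain_chainVec n L hanti hcomp
  obtain ⟨σ, -, hσ⟩ := Finset.exists_ne_zero_of_sum_ne_zero (hsum ▸ one_ne_zero)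
  obtain ⟨ε, -, hε⟩ := Finset.exists_ne_zero_of_sum_ne_zero hσ
  have := card_le_of_altList_ne_zero _ m true (Multiset.pairwise_sort _ _) ?_ ?_ hε
  · simpa [tupleVals] using this
  · intro x hx
    simp only [Multiset.mem_sort, tupleVals, Multiset.mem_map] at hx
    obtain ⟨j, -, rfl⟩ := hx
    exact hm _ (chainVec_ne_zero _ _ _)
  · intro x hx y hy
    simp only [Multiset.mem_sort, tupleVals, Multiset.mem_map] at hx hy
    obtain ⟨j, -, rfl⟩ := hx
    obtain ⟨k, -, rfl⟩ := hy
    rcases le_total j k with h | h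
    · intro he
      refine hcomp _ _ (chainVec_ne_zero σ ε k) (chainVec_le σ ε h) ?_
      rw [he]; simp [labelNeg]
    · exact hcomp _ _ (chainVec_ne_zero σ ε j) (chainVec_le σ ε h)

/-! ### The lower bound by alternating subsequences. -/

/-- The sign named by a Boolean. -/
def boolSign (b : Bool) : SignType := if b then 1 else -1

theorem boolSign_not (b : Bool) : boolSign (!b) = -boolSign b := by cases b <;> rfl

theorem boolSign_ne_zero (b : Bool) : boolSign b ≠ 0 := by cases b <;> decide

/-- `x` has an alternating subsequence of length `k` whose first sign is `b`. -/
def AltSeq {N : ℕ} (x : Fin N → SignType) (b : Bool) (k : ℕ) : Prop :=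
  ∃ f : Fin k → Fin N, StrictMono f ∧ ∀ i, x (f i) = (-1) ^ i.val * boolSign b

theorem AltSeq.mono {N : ℕ} {x y : Fin N → SignType} {b : Bool} {k : ℕ} (h : AltSeq x b k)
    (hxy : ∀ i, x i ≠ 0 → y i = x i) : AltSeq y b k := by
  obtain ⟨f, hf, hx⟩ := h
  refine ⟨f, hf, fun i => ?_⟩
  rw [← hx, hxy]
  rw [hx]
  refine mul_ne_zero (pow_ne_zero _ (by decide)) (boolSign_ne_zero b)

theorem altSeq_neg {N : ℕ} (x : Fin N → SignType) (b : Bool) (k : ℕ) :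
    AltSeq (-x) b k ↔ AltSeq x (!b) k := by
  refine exists_congr fun f => and_congr_right fun _ => forall_congr' fun i => ?_
  rw [Pi.neg_apply, boolSign_not, mul_neg, neg_eq_iff_eq_neg]

theorem AltSeq.of_le {N : ℕ} {x : Fin N → SignType} {b : Bool} {k l : ℕ} (h : AltSeq x b l)
    (hkl : k ≤ l) : AltSeq x b k := by
  obtain ⟨f, hf, hx⟩ := h
  exact ⟨fun i => f (Fin.castLE hkl i), fun i j hij => hf hij,
    fun i => hx _⟩

theorem AltSeq.le {N : ℕ} {x : Fin N → SignType} {b : Bool} {k : ℕ} (h : AltSeq x b k) :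
    k ≤ N := by
  obtain ⟨f, hf, _⟩ := h
  simpa using Fintype.card_le_of_injective f hf.injective

theorem altSeq_cons {N : ℕ} {x : Fin N → SignType} {b : Bool} {k : ℕ} (g : Fin k → Fin N)
    (hg : StrictMono g) (hx : ∀ i, x (g i) = (-1) ^ i.val * boolSign (!b)) (a : Fin N)
    (ha : x a = boolSign b) (hag : ∀ i, a < g i) : AltSeq x b (k + 1) := by
  refine ⟨Fin.cons a g, ?_, ?_⟩
  · intro i j
    refine Fin.cases ?_ (fun i => ?_) i <;> refine Fin.cases ?_ (fun j => ?_) j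
    · simp
    · intro _; simpa using hag j
    · intro h; simp at h
    · intro h; simpa using hg (by simpa using h)
  · intro i
    refine Fin.cases ?_ (fun i => ?_) i
    · simpa using ha
    · simp [hx, boolSign_not, pow_succ]

/-- The earlier of the two starting points can be put in front of the other sequence. Hence a
longest alternating subsequence has a determined first sign. -/
theorem altSeq_succ_of_both {N : ℕ} {x : Fin N → SignType} {k : ℕ}
    (h1 : AltSeq x true (k + 1)) (h2 : AltSeq x false (k + 1)) : ∃ b, AltSeq x b (k + 2) := by
  obtain ⟨f, hf, hxf⟩ := h1
  obtain ⟨g, hg, hxg⟩ := h2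
  have hf0 : x (f 0) = boolSign true := by simpa using hxf 0
  have hg0 : x (g 0) = boolSign false := by simpa using hxg 0
  rcases lt_trichotomy (f 0) (g 0) with h | h | h
  · exact ⟨true, altSeq_cons g hg hxg _ hf0 fun i => h.trans_le (hg.monotone (Fin.zero_le i))⟩
  · rw [h, hg0] at hf0; exact absurd hf0 (by decide)
  · exact ⟨false, altSeq_cons f hf hxf _ hg0 fun i => h.trans_le (hf.monotone (Fin.zero_le i))⟩

theorem altSeq_one_of_ne_zero {N : ℕ} {x : Fin N → SignType} (hx : x ≠ 0) :
    ∃ b, AltSeq x b 1 := by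
  obtain ⟨i, hi⟩ := Function.ne_iff.1 hx
  have : ∀ s : SignType, s ≠ 0 → ∃ b, s = boolSign b := by decide
  obtain ⟨b, hb⟩ := this _ hi
  exact ⟨b, fun _ => i, Subsingleton.strictMono _, fun j => by simp [hb]⟩

open Classical in
/-- The largest `k ≤ N` at which a signed family of predicates holds for some sign. -/
noncomputable def topLevel (q : Bool → ℕ → Prop) (N : ℕ) : ℕ :=
  Nat.findGreatest (fun k => ∃ b, q b k) N

open Classical in
/-- The sign for which the predicate holds at the largest level. -/
noncomputable def topSign (q : Bool → ℕ → Prop) (N : ℕ) : Bool := decide (q true (topLevel q N))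

theorem topLevel_spec {q : Bool → ℕ → Prop} {N k : ℕ} {b : Bool} (h : q b k) (hk : k ≤ N) :
    ∃ b, q b (topLevel q N) := by
  classical
  exact Nat.findGreatest_spec (P := fun k => ∃ b, q b k) hk ⟨b, h⟩

theorem le_topLevel {q : Bool → ℕ → Prop} {N k : ℕ} {b : Bool} (h : q b k) (hk : k ≤ N) :
    k ≤ topLevel q N := by
  classical
  exact Nat.le_findGreatest hk ⟨b, h⟩

theorem topLevel_neg {q q' : Bool → ℕ → Prop} {N : ℕ} (h : ∀ b k, q' b k ↔ q (!b) k) :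
    topLevel q' N = topLevel q N := by
  have : (fun k => ∃ b, q' b k) = fun k => ∃ b, q b k := by
    funext k
    simp only [h, Bool.exists_bool, eq_iff_iff]
    exact or_comm
  rw [topLevel, topLevel]
  congr

theorem topSign_eq_iff {q : Bool → ℕ → Prop} {N : ℕ} (hex : ∃ b, q b (topLevel q N))
    (hun : ¬ (q true (topLevel q N) ∧ q false (topLevel q N))) (b : Bool) :
    topSign q N = b ↔ q b (topLevel q N) := by
  obtain ⟨c, hc⟩ := hex
  unfold topSign
  cases b <;> cases c <;> simp_all

theorem topSign_neg {q q' : Bool → ℕ → Prop} {N : ℕ} (h : ∀ b k, q' b k ↔ q (!b) k)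
    (hex : ∃ b, q b (topLevel q N))
    (hun : ¬ (q true (topLevel q N) ∧ q false (topLevel q N))) :
    topSign q' N = !topSign q N := by
  have h1 := topLevel_neg (N := N) h
  rw [topSign_eq_iff, h1, h, Bool.not_not, ← topSign_eq_iff hex hun]
  · rw [h1]; obtain ⟨b, hb⟩ := hex; exact ⟨!b, by rw [h, Bool.not_not]; exact hb⟩
  · rw [h1, h, h]; exact fun h => hun h.symm

theorem topSign_mono {q q' : Bool → ℕ → Prop} {N : ℕ} (h : ∀ b k, q b k → q' b k)
    (he : topLevel q' N = topLevel q N) (hex : ∃ b, q b (topLevel q N))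
    (hun : ¬ (q true (topLevel q N) ∧ q false (topLevel q N)))
    (hun' : ¬ (q' true (topLevel q' N) ∧ q' false (topLevel q' N))) :
    topSign q' N = topSign q N := by
  rw [topSign_eq_iff _ hun', he]
  · exact h _ _ ((topSign_eq_iff hex hun _).1 rfl)
  · rw [he]; obtain ⟨b, hb⟩ := hex; exact ⟨b, h _ _ hb⟩

/-- A colour `k` appears on a member of the family inside the part of sign `b` of `x`. -/
def ColorAt {N : ℕ} {ι : Type*} (S : ι → Finset (Fin N)) (c : ι → ℕ) (x : Fin N → SignType)
    (b : Bool) (k : ℕ) : Prop :=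
  ∃ i, (∀ e ∈ S i, x e = boolSign b) ∧ c i = k

theorem ColorAt.mono {N : ℕ} {ι : Type*} {S : ι → Finset (Fin N)} {c : ι → ℕ}
    {x y : Fin N → SignType} {b : Bool} {k : ℕ} (h : ColorAt S c x b k)
    (hxy : ∀ i, x i ≠ 0 → y i = x i) : ColorAt S c y b k := by
  obtain ⟨i, hi, hk⟩ := h
  exact ⟨i, fun e he => by rw [hxy _ (by rw [hi e he]; exact boolSign_ne_zero b), hi e he], hk⟩

theorem colorAt_neg {N : ℕ} {ι : Type*} (S : ι → Finset (Fin N)) (c : ι → ℕ)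
    (x : Fin N → SignType) (b : Bool) (k : ℕ) :
    ColorAt S c (-x) b k ↔ ColorAt S c x (!b) k := by
  refine exists_congr fun i => and_congr_left fun _ => forall₂_congr fun e _ => ?_
  rw [Pi.neg_apply, boolSign_not, neg_eq_iff_eq_neg]

/-- The lower bound by alternation: a family of sets on `N` ordered points, coloured so that
disjoint sets get different colours. -/
theorem le_add_of_altSeq {N C α s : ℕ} {ι : Type*} (S : ι → Finset (Fin N)) (c : ι → ℕ)
    (hC : ∀ i, c i < C) (hc : ∀ i j, Disjoint (S i) (S j) → c i ≠ c j)
    (H : ∀ x : Fin N → SignType, (∃ b, AltSeq x b (α + 1)) → ∃ b k, s ≤ k ∧ ColorAt S c x b k) :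
    N ≤ α + (C - s) := by
  classical
  have colUn : ∀ (x : Fin N → SignType) k, ¬ (ColorAt S c x true k ∧ ColorAt S c x false k) := by
    rintro x k ⟨⟨i, hi, hik⟩, ⟨j, hj, hjk⟩⟩
    refine hc i j ?_ (hik.trans hjk.symm)
    rw [Finset.disjoint_left]
    intro e he he'
    have := (hi e he).symm.trans (hj e he')
    exact absurd this (by decide)
  have colLe : ∀ (x : Fin N → SignType) b k, ColorAt S c x b k → k < C := by
    rintro x b k ⟨i, _, rfl⟩; exact hC i
  have colEx : ∀ x : Fin N → SignType, (∃ b, AltSeq x b (α + 1)) →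
      (∃ b, ColorAt S c x b (topLevel (ColorAt S c x) C)) ∧ s ≤ topLevel (ColorAt S c x) C := by
    intro x hx
    obtain ⟨b, k, hk, h⟩ := H x hx
    exact ⟨topLevel_spec h (colLe _ _ _ h).le, hk.trans (le_topLevel h (colLe _ _ _ h).le)⟩
  have altEx : ∀ x : Fin N → SignType, x ≠ 0 →
      (∃ b, AltSeq x b (topLevel (AltSeq x) N)) ∧ 1 ≤ topLevel (AltSeq x) N := by
    intro x hx
    obtain ⟨b, h⟩ := altSeq_one_of_ne_zero hx
    exact ⟨topLevel_spec h h.le, le_topLevel h h.le⟩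
  have altUn : ∀ x : Fin N → SignType, x ≠ 0 →
      ¬ (AltSeq x true (topLevel (AltSeq x) N) ∧ AltSeq x false (topLevel (AltSeq x) N)) := by
    rintro x hx ⟨h1, h2⟩
    obtain ⟨k, hk⟩ := Nat.exists_eq_add_of_le' (altEx x hx).2
    rw [hk] at h1 h2
    obtain ⟨b, hb⟩ := altSeq_succ_of_both h1 h2
    have := le_topLevel hb hb.le
    omega
  have altLow : ∀ x : Fin N → SignType, x ≠ 0 → ¬ (∃ b, AltSeq x b (α + 1)) →
      topLevel (AltSeq x) N ≤ α := by
    intro x hx hlow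
    by_contra hlt
    obtain ⟨b, hb⟩ := (altEx x hx).1
    exact hlow ⟨b, hb.of_le (by omega)⟩
  have negIff : ∀ x : Fin N → SignType,
      (∃ b, AltSeq (-x) b (α + 1)) ↔ ∃ b, AltSeq x b (α + 1) := by
    intro x
    simp only [altSeq_neg, Bool.exists_bool]
    exact or_comm
  -- Vectors of small alternation are labelled below `α` by their alternation length and first sign.
  -- The others are labelled from `α` on by the largest colour inside a sign class, together with
  -- that sign; this colour is at least `s`, so `C - s` numbers suffice.
  refine octahedral_tucker (fun x => if ∃ b, AltSeq x b (α + 1) then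
    (α + (topLevel (ColorAt S c x) C - s), topSign (ColorAt S c x) C) else
    (topLevel (AltSeq x) N - 1, topSign (AltSeq x) N)) ?_ ?_ ?_
  · intro x hx
    split_ifs with h
    · obtain ⟨⟨b, hb⟩, h2⟩ := colEx x h
      have := colLe _ _ _ hb
      dsimp only; omega
    · have := altLow x hx h
      have := (altEx x hx).2
      dsimp only; omega
  · intro x hx
    simp only [negIff]
    split_ifs with h
    · rw [topLevel_neg (colorAt_neg S c x),
        topSign_neg (colorAt_neg S c x) (colEx x h).1 (colUn _ _), labelNeg]
    · rw [topLevel_neg (altSeq_neg x), topSign_neg (altSeq_neg x) (altEx x hx).1 (altUn x hx),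
        labelNeg]
  · intro x y hx hxy
    have hy : y ≠ 0 := by
      obtain ⟨i, hi⟩ := Function.ne_iff.1 hx
      refine Function.ne_iff.2 ⟨i, ?_⟩
      rw [hxy i hi]; exact hi
    -- The two ranges of numbers are disjoint. Within one range equal numbers mean equal levels, and
    -- then the sign found in `x` is still the one found in `y`.
    split_ifs with h1 h2 h2
    · intro he
      rw [labelNeg, Prod.mk.injEq] at he
      have e1 := (colEx x h2).2
      have e2 := (colEx y h1).2
      have := topSign_mono (q := ColorAt S c x) (q' := ColorAt S c y)
        (fun b k (h : ColorAt S c x b k) => h.mono hxy) (by omega)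
        (colEx x h2).1 (colUn _ _) (colUn y _)
      rw [this] at he
      simp at he
    · intro he
      rw [labelNeg, Prod.mk.injEq] at he
      have e1 := altLow x hx h2
      have e2 := (altEx x hx).2
      dsimp only at he; omega
    · obtain ⟨b, hb⟩ := h2
      exact absurd ⟨b, hb.mono hxy⟩ h1
    · intro he
      rw [labelNeg, Prod.mk.injEq] at he
      have e1 := (altEx x hx).2
      have e2 := (altEx y hy).2
      have := topSign_mono (q := AltSeq x) (q' := AltSeq y)
        (fun b k (h : AltSeq x b k) => h.mono hxy) (by dsimp only at he; omega)
        (altEx x hx).1 (altUn x hx) (altUn y hy)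
      rw [this] at he
      simp at he

/-! ### Euler tours and edges selected along a walk. -/

namespace SimpleGraph

variable {V : Type*} {G : SimpleGraph V}

/-- A connected graph with even degrees has a closed Eulerian trail. -/
theorem Connected.exists_isEulerian [Fintype V] [DecidableEq V] [DecidableRel G.Adj]
    (hG : G.Connected) (heven : ∀ v, Even (G.degree v)) (a : V) :
    ∃ p : G.Walk a a, p.IsEulerian := by
  classical
  have bound : ∀ (u v : V) (p : G.Walk u v), p.IsTrail → p.length ≤ G.edgeFinset.card := by
    intro u v p hp
    rw [← p.length_edges, ← List.toFinset_card_of_nodup hp.edges_nodup]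
    refine Finset.card_le_card fun e he => ?_
    rw [mem_edgeFinset]
    exact p.edges_subset_edgeSet (List.mem_toFinset.1 he)
  let Q : ℕ → Prop := fun k => ∃ (u v : V) (p : G.Walk u v), p.IsTrail ∧ p.length = k
  have hQ0 : Q 0 := ⟨a, a, Walk.nil, Walk.IsTrail.nil, rfl⟩
  obtain ⟨u, v, p, hp, hlen⟩ := Nat.findGreatest_spec (P := Q) (Nat.zero_le G.edgeFinset.card) hQ0
  have hmax : ∀ (u' v' : V) (q : G.Walk u' v'), q.IsTrail → q.length ≤ p.length := by
    intro u' v' q hq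
    rw [hlen]
    exact Nat.le_findGreatest (bound _ _ _ hq) ⟨u', v', q, hq, rfl⟩
  -- For a longest trail that is not closed, an odd number of its edges meet `u`; the degree is
  -- even, so an unused edge prolongs it.
  have huv : u = v := by
    by_contra hne
    have hodd := (hp.even_countP_edges_iff u).not.2 (by simp [hne])
    obtain ⟨e, he, hep⟩ : ∃ e ∈ G.incidenceFinset u, e ∉ p.edges := by
      by_contra! hall
      apply hodd
      have : p.edges.countP (fun e => u ∈ e) = G.degree u := by
        rw [← G.card_incidenceFinset_eq_degree, List.countP_eq_length_filter,
          ← List.toFinset_card_of_nodup (hp.edges_nodup.filter _)]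
        congr 1
        ext e
        simp only [List.mem_toFinset, List.mem_filter, decide_eq_true_eq, mem_incidenceFinset,
          incidenceSet, Set.mem_ofPred_eq]
        constructor
        · rintro ⟨h1, h2⟩; exact ⟨p.edges_subset_edgeSet h1, h2⟩
        · rintro ⟨h1, h2⟩; exact ⟨hall e (by simp [incidenceSet, h1, h2]), h2⟩
      rw [this]; exact heven u
    rw [mem_incidenceFinset, incidenceSet, Set.mem_ofPred_eq] at he
    obtain ⟨he1, w, rfl⟩ := he
    have := hmax _ _ (Walk.cons (G.mem_edgeSet.1 he1).symm p) (by
      rw [Walk.isTrail_cons]; exact ⟨hp, by rwa [Sym2.eq_swap]⟩)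
    simp at this
  subst huv
  -- The closed trail may be rotated to start at `x`, where an unused edge would prolong it.
  have hall : ∀ x ∈ p.support, ∀ y, G.Adj x y → s(x, y) ∈ p.edges := by
    intro x hx y hxy
    by_contra hnot
    have h1 := hmax _ _ (Walk.cons hxy.symm (p.rotate x hx)) (by
      rw [Walk.isTrail_cons, Walk.isTrail_rotate]
      refine ⟨hp, ?_⟩
      rw [(p.rotate_edges x hx).perm.mem_iff, Sym2.eq_swap]; exact hnot)
    simp at h1
  have hsupp : ∀ x, x ∈ p.support := by
    intro x
    obtain ⟨q⟩ := hG.preconnected u x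
    have : ∀ {y z : V} (q : G.Walk y z), y ∈ p.support → z ∈ p.support := by
      intro y z q
      induction q with
      | nil => exact id
      | cons h q ih =>
        intro hy
        exact ih (p.snd_mem_support_of_mem_edges (hall _ hy _ h))
    exact this q p.start_mem_support
  refine ⟨p.rotate a (hsupp a), ?_⟩
  apply Walk.IsTrail.isEulerian_of_forall_mem
  · simpa using hp
  · intro e
    refine Sym2.ind (fun x y => ?_) e
    intro h
    rw [(p.rotate_edges a _).perm.mem_iff]
    exact hall x (hsupp x) y h

/-- Along a walk, edges no two of which are consecutive use at most about half of the
incidences at each vertex. Here `B` tells whether an imaginary edge arriving at the start is in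
the family. -/
theorem Walk.two_mul_countP_le [DecidableEq V] (P : Sym2 V → Bool) (v : V) {a b : V}
    (p : G.Walk a b) (B : Bool)
    (hc : List.IsChain (fun x y => ¬ (x = true ∧ y = true)) (B :: p.edges.map P)) :
    2 * (p.edges.countP (fun e => P e && decide (v ∈ e)) : ℤ) +
        (if a = v then (if B then 1 else -1) else 0) ≤
      p.edges.countP (fun e => decide (v ∈ e)) +
        (if b = v then (if (p.edges.map P).getLastD B then 1 else -1) else 0) := by
  -- The term `±1` at the current vertex records whether the last edge was selected. Arriving at `v`
  -- balances exactly; leaving `v` loses nothing because the arriving and departing edges are not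
  -- both selected.
  induction p generalizing B with
  | nil => simp
  | @cons a x b h p ih =>
    rw [edges_cons, List.map_cons, List.isChain_cons_cons] at hc
    have := ih _ hc.2
    rw [edges_cons, List.map_cons, List.getLastD_cons, List.countP_cons, List.countP_cons]
    have hne := h.ne
    have hc1 := hc.1
    generalize (if b = v then (if (p.edges.map P).getLastD (P s(a, x)) then (1 : ℤ) else -1)
      else 0) = T at this ⊢
    by_cases h1 : a = v
    · subst h1
      have h2 : x ≠ a := hne.symm
      simp only [if_neg h2] at this
      simp only [Sym2.mem_iff, true_or, decide_true, Bool.and_true, if_true]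
      cases B <;> cases hP : P s(a, x) <;> simp_all <;> omega
    · by_cases h2 : x = v
      · subst h2
        simp only [Sym2.mem_iff, or_true, decide_true, Bool.and_true, if_true, if_neg h1] at *
        cases hP : P s(a, x) <;> simp_all <;> omega
      · have h1' : v ≠ a := fun h => h1 h.symm
        have h2' : v ≠ x := fun h => h2 h.symm
        simp only [Sym2.mem_iff, h1', h2', h1, h2, or_false, decide_false, Bool.and_false,
          if_false] at *
        simpa using this

end SimpleGraph

/-! ### Maximum matchings, exchange, and covers of edge sets without large matchings. -/

section Matchings

variable {V : Type*}

/-- A set of edges no two of which share a vertex. -/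
def IsMatch (M : Finset (Sym2 V)) : Prop := ∀ e ∈ M, ∀ f ∈ M, ∀ v, v ∈ e → v ∈ f → e = f

/-- A maximum matching inside `H`. -/
def IsMaxMatch (H M : Finset (Sym2 V)) : Prop :=
  M ⊆ H ∧ IsMatch M ∧ ∀ M' ⊆ H, IsMatch M' → M'.card ≤ M.card

theorem isMatch_empty : IsMatch (∅ : Finset (Sym2 V)) := by simp [IsMatch]

theorem IsMatch.subset {M N : Finset (Sym2 V)} (h : IsMatch N) (hMN : M ⊆ N) : IsMatch M :=
  fun e he f hf => h e (hMN he) f (hMN hf)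

theorem exists_isMaxMatch (H : Finset (Sym2 V)) : ∃ M, IsMaxMatch H M := by
  classical
  obtain ⟨M, hM, hmax⟩ := (H.powerset.filter IsMatch).exists_max_image Finset.card
    ⟨∅, by simp [isMatch_empty]⟩
  simp only [Finset.mem_filter, Finset.mem_powerset] at hM hmax
  exact ⟨M, hM.1, hM.2, fun M' h1 h2 => hmax M' ⟨h1, h2⟩⟩

theorem IsMaxMatch.card_eq {H M N : Finset (Sym2 V)} (hM : IsMaxMatch H M)
    (hN : IsMaxMatch H N) : M.card = N.card :=
  le_antisymm (hN.2.2 _ hM.1 hM.2.1) (hM.2.2 _ hN.1 hN.2.1)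

variable [DecidableEq V]

/-- The vertices covered by a set of edges. -/
def coveredVerts (M : Finset (Sym2 V)) : Finset V := M.biUnion Sym2.toFinset

theorem mem_coveredVerts {M : Finset (Sym2 V)} {v : V} :
    v ∈ coveredVerts M ↔ ∃ e ∈ M, v ∈ e := by
  simp [coveredVerts]

theorem IsMatch.card_coveredVerts {M : Finset (Sym2 V)} (h : IsMatch M)
    (hL : ∀ e ∈ M, ¬ e.IsDiag) : (coveredVerts M).card = 2 * M.card := by
  rw [coveredVerts, Finset.card_biUnion, Finset.sum_congr rfl fun e he =>
    Sym2.card_toFinset_of_not_isDiag e (hL e he)]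
  · simp [mul_comm]
  · intro e he f hf hef
    rw [Function.onFun, Finset.disjoint_left]
    intro v hv hv'
    exact hef (h e he f hf v (by simpa using hv) (by simpa using hv'))

theorem IsMatch.insert {N : Finset (Sym2 V)} (h : IsMatch N) {x y : V}
    (hx : x ∉ coveredVerts N) (hy : y ∉ coveredVerts N) : IsMatch (insert s(x, y) N) := by
  have key : ∀ f ∈ N, ∀ v, v ∈ s(x, y) → v ∉ f := by
    intro f hf v hv hvf
    rcases Sym2.mem_iff.1 hv with rfl | rfl
    · exact hx (mem_coveredVerts.2 ⟨f, hf, hvf⟩)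
    · exact hy (mem_coveredVerts.2 ⟨f, hf, hvf⟩)
  intro e he f hf v hve hvf
  rcases Finset.mem_insert.1 he with rfl | he <;> rcases Finset.mem_insert.1 hf with rfl | hf
  · rfl
  · exact absurd hvf (key f hf v hve)
  · exact absurd hve (key e he v hvf)
  · exact h e he f hf v hve hvf

theorem IsMaxMatch.mem_or_mem {H N : Finset (Sym2 V)} (h : IsMaxMatch H N) {x y : V}
    (he : s(x, y) ∈ H) : x ∈ coveredVerts N ∨ y ∈ coveredVerts N := by
  by_contra! hxy
  have hnot : s(x, y) ∉ N := fun hN => hxy.1 (mem_coveredVerts.2 ⟨_, hN, by simp⟩)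
  have := h.2.2 _ (Finset.insert_subset he h.1) (h.2.1.insert hxy.1 hxy.2)
  rw [Finset.card_insert_of_notMem hnot] at this
  omega

/-- Among the maximum matchings missing `v`, one covers everything that `M` covers except `v`. -/
theorem IsMaxMatch.exists_exchange {H M : Finset (Sym2 V)} (hM : IsMaxMatch H M) (v : V)
    (hv : ∃ N, IsMaxMatch H N ∧ v ∉ coveredVerts N) :
    ∃ N, IsMaxMatch H N ∧ v ∉ coveredVerts N ∧ (coveredVerts M).erase v ⊆ coveredVerts N := by
  classical
  obtain ⟨N₀, hN₀⟩ := hv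
  -- `N` is chosen to share as many edges with `M` as possible. If it missed some `x ≠ v` on an edge
  -- `xy` of `M`, replacing the edge of `N` at `y` by `xy` would increase the overlap and still miss
  -- `v`.
  obtain ⟨N, hN, hmax⟩ := (H.powerset.filter
    fun N => IsMaxMatch H N ∧ v ∉ coveredVerts N).exists_max_image (fun N => (M ∩ N).card)
    ⟨N₀, by simp [hN₀, hN₀.1.1]⟩
  simp only [Finset.mem_filter, Finset.mem_powerset] at hN hmax
  obtain ⟨hNH, hN, hvN⟩ := hN
  refine ⟨N, hN, hvN, ?_⟩
  intro x hx
  obtain ⟨hxv, hxM⟩ := Finset.mem_erase.1 hx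
  by_contra hxN
  obtain ⟨e, heM, hxe⟩ := mem_coveredVerts.1 hxM
  obtain ⟨y, rfl⟩ := Sym2.mem_iff_exists.1 hxe
  have hyN := (hN.mem_or_mem (hM.1 heM)).resolve_left hxN
  obtain ⟨f, hfN, hyf⟩ := mem_coveredVerts.1 hyN
  have heN : s(x, y) ∉ N := fun h => hxN (mem_coveredVerts.2 ⟨_, h, by simp⟩)
  have hfM : f ∉ M := by
    intro hfM
    have := hM.2.1 _ hfM _ heM y hyf (by simp)
    exact heN (this ▸ hfN)
  have hx' : x ∉ coveredVerts (N.erase f) := fun h => by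
    obtain ⟨g, hg, hxg⟩ := mem_coveredVerts.1 h
    exact hxN (mem_coveredVerts.2 ⟨g, Finset.mem_of_mem_erase hg, hxg⟩)
  have hy' : y ∉ coveredVerts (N.erase f) := fun h => by
    obtain ⟨g, hg, hyg⟩ := mem_coveredVerts.1 h
    exact (Finset.mem_erase.1 hg).1 (hN.2.1 _ (Finset.mem_of_mem_erase hg) _ hfN y hyg hyf)
  have hcard : (insert s(x, y) (N.erase f)).card = N.card := by
    rw [Finset.card_insert_of_notMem (fun h => heN (Finset.mem_of_mem_erase h)),
      Finset.card_erase_add_one hfN]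
  have hsub : insert s(x, y) (N.erase f) ⊆ H :=
    Finset.insert_subset (hM.1 heM) ((Finset.erase_subset _ _).trans hNH)
  have hlt := hmax (insert s(x, y) (N.erase f)) ⟨hsub,
    ⟨hsub, (hN.2.1.subset (Finset.erase_subset _ _)).insert hx' hy', by
      rw [hcard]; exact hN.2.2⟩, ?_⟩
  · have : insert s(x, y) (M ∩ N) ⊆ M ∩ insert s(x, y) (N.erase f) := by
      intro g hg
      rcases Finset.mem_insert.1 hg with rfl | hg
      · simp [heM]
      · obtain ⟨h1, h2⟩ := Finset.mem_inter.1 hg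
        simp only [Finset.mem_inter, h1, Finset.mem_insert, Finset.mem_erase, h2, and_true,
          true_and]
        exact Or.inr fun h => hfM (h ▸ h1)
    have := Finset.card_le_card this
    rw [Finset.card_insert_of_notMem (fun h => heN (Finset.mem_inter.1 h).2)] at this
    omega
  · intro h
    obtain ⟨g, hg, hvg⟩ := mem_coveredVerts.1 h
    rcases Finset.mem_insert.1 hg with rfl | hg
    · rcases Sym2.mem_iff.1 hvg with rfl | rfl
      · exact hxv rfl
      · exact hvN hyN
    · exact hvN (mem_coveredVerts.2 ⟨g, Finset.mem_of_mem_erase hg, hvg⟩)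

theorem IsMaxMatch.card_coveredVerts {H M : Finset (Sym2 V)} (hM : IsMaxMatch H M)
    (hL : ∀ e ∈ H, ¬ e.IsDiag) : (coveredVerts M).card = 2 * M.card :=
  hM.2.1.card_coveredVerts fun e he => hL e (hM.1 he)

/-- If every vertex is missed by a maximum matching, no vertex has two neighbours missed by the
same maximum matching. -/
theorem IsMaxMatch.eq_of_missed {H M : Finset (Sym2 V)} (hM : IsMaxMatch H M)
    (hL : ∀ e ∈ H, ¬ e.IsDiag) (hv : ∀ v, ∃ N, IsMaxMatch H N ∧ v ∉ coveredVerts N)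
    {v u w : V} (hu : s(v, u) ∈ H) (hw : s(v, w) ∈ H) (huM : u ∉ coveredVerts M)
    (hwM : w ∉ coveredVerts M) : u = w := by
  by_contra huw
  obtain ⟨N, hN, hvN, hsub⟩ := hM.exists_exchange v (hv v)
  have huN := (hN.mem_or_mem hu).resolve_left hvN
  have hwN := (hN.mem_or_mem hw).resolve_left hvN
  -- This would make `N` cover more vertices than `M`, although both are maximum.
  have h1 : insert u (insert w ((coveredVerts M).erase v)) ⊆ coveredVerts N :=
    Finset.insert_subset huN (Finset.insert_subset hwN hsub)
  have h2 := Finset.card_le_card h1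
  rw [Finset.card_insert_of_notMem, Finset.card_insert_of_notMem, hN.card_coveredVerts hL,
    ← hM.card_eq hN, ← hM.card_coveredVerts hL] at h2
  · have := Finset.pred_card_le_card_erase (s := coveredVerts M) (a := v)
    omega
  · exact fun h => hwM (Finset.mem_of_mem_erase h)
  · simp [huw, huM]

/-- Every edge has a covered end, and by `IsMaxMatch.eq_of_missed` each covered `w` has at most one
edge to a missed vertex. Encoding that edge as the loop `s(w, w)` embeds `H` into the unordered
pairs, loops included, of the `2 * M.card` covered vertices. -/
theorem IsMaxMatch.card_le {H M : Finset (Sym2 V)} (hM : IsMaxMatch H M)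
    (hL : ∀ e ∈ H, ¬ e.IsDiag) (hv : ∀ v, ∃ N, IsMaxMatch H N ∧ v ∉ coveredVerts N) :
    H.card ≤ M.card * (2 * M.card + 1) := by
  have hex : ∀ e ∈ H, ∃ z ∈ (coveredVerts M).sym2, (z = e) ∨
      ∃ w u, e = s(w, u) ∧ u ∉ coveredVerts M ∧ z = s(w, w) := by
    intro e
    refine Sym2.ind (fun x y => ?_) e
    intro he
    by_cases hx : x ∈ coveredVerts M
    · by_cases hy : y ∈ coveredVerts M
      · exact ⟨s(x, y), by simp [hx, hy], Or.inl rfl⟩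
      · exact ⟨s(x, x), by simp [hx], Or.inr ⟨x, y, rfl, hy, rfl⟩⟩
    · have hy := (hM.mem_or_mem he).resolve_left hx
      exact ⟨s(y, y), by simp [hy], Or.inr ⟨y, x, Sym2.eq_swap, hx, rfl⟩⟩
  choose! φ hφ hφ' using hex
  have := Finset.card_le_card_of_injOn φ hφ (by
    intro e he f hf hef
    rcases hφ' e he with h1 | ⟨w, u, rfl, hu, h1⟩ <;>
      rcases hφ' f hf with h2 | ⟨w', u', rfl, hu', h2⟩
    · rw [← h1, ← h2, hef]
    · exfalso
      apply hL e he
      rw [← h1, hef, h2]; simp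
    · exfalso
      apply hL f hf
      rw [← h2, ← hef, h1]; simp
    · rw [h1, h2] at hef
      have hw : w = w' := by simpa using hef
      subst hw
      rw [hM.eq_of_missed hL hv he hf hu hu'])
  rw [Finset.card_sym2, hM.card_coveredVerts hL, Nat.choose_two_right] at this
  refine this.trans (le_of_eq ?_)
  rw [Nat.add_sub_cancel, show (2 * M.card + 1) * (2 * M.card) =
    M.card * (2 * M.card + 1) * 2 by ring, Nat.mul_div_cancel _ two_pos]

theorem IsMatch.card_filter_coveredVerts {M : Finset (Sym2 V)} (h : IsMatch M) (col : V → Bool)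
    (hcol : ∀ x y, s(x, y) ∈ M → col x ≠ col y) (c : Bool) :
    ((coveredVerts M).filter fun v => col v = c).card = M.card := by
  rw [coveredVerts, Finset.filter_biUnion, Finset.card_biUnion, Finset.sum_congr rfl (g := 1)]
  · simp
  · intro e
    refine Sym2.ind (fun x y => ?_) e
    intro he
    have := hcol x y he
    rw [Pi.one_apply, Finset.card_eq_one]
    by_cases hx : col x = c
    · refine ⟨x, ?_⟩
      ext z
      simp only [Finset.mem_filter, Sym2.mem_toFinset, Sym2.mem_iff, Finset.mem_singleton]
      constructor
      · rintro ⟨rfl | rfl, h⟩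
        · rfl
        · exact absurd (hx.trans h.symm) this
      · rintro rfl; exact ⟨Or.inl rfl, hx⟩
    · refine ⟨y, ?_⟩
      have hy : col y = c := by
        cases hcx : col x <;> cases hcy : col y <;> cases c <;> simp_all
      ext z
      simp only [Finset.mem_filter, Sym2.mem_toFinset, Sym2.mem_iff, Finset.mem_singleton]
      constructor
      · rintro ⟨rfl | rfl, h⟩
        · exact absurd h hx
        · rfl
      · rintro rfl; exact ⟨Or.inr rfl, hy⟩
  · intro e he f hf hef
    rw [Function.onFun, Finset.disjoint_left]
    intro v hv hv'
    simp only [Finset.mem_filter, Sym2.mem_toFinset] at hv hv'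
    exact hef (h e he f hf v hv.1 hv'.1)

/-- A bipartite set of edges in which every vertex is missed by a maximum matching is empty. -/
theorem eq_empty_of_bipartite_of_missed {H : Finset (Sym2 V)} (col : V → Bool)
    (hcol : ∀ x y, s(x, y) ∈ H → col x ≠ col y)
    (hv : ∀ v, ∃ N, IsMaxMatch H N ∧ v ∉ coveredVerts N) : H = ∅ := by
  rw [Finset.eq_empty_iff_forall_notMem]
  intro e
  refine Sym2.ind (fun u v => ?_) e
  intro he
  have hL : ∀ e ∈ H, ¬ e.IsDiag := by
    intro e
    refine Sym2.ind (fun u v => ?_) e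
    intro he hd
    exact hcol _ _ he (by rw [Sym2.mk_isDiag_iff.1 hd])
  obtain ⟨M, hM, huM⟩ := hv u
  obtain ⟨N, hN, hvN, hsub⟩ := hM.exists_exchange v (hv v)
  have huN := (hN.mem_or_mem he).resolve_right hvN
  -- In the colour class of `u`, `N` covers all that `M` covers and also `u`; but a bipartite
  -- matching covers as many vertices of each class as it has edges.
  have hsub' : insert u ((coveredVerts M).filter fun w => col w = col u) ⊆
      (coveredVerts N).filter fun w => col w = col u := by
    intro w hw
    rcases Finset.mem_insert.1 hw with rfl | hw
    · simp [huN]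
    · obtain ⟨h1, h2⟩ := Finset.mem_filter.1 hw
      refine Finset.mem_filter.2 ⟨hsub (Finset.mem_erase.2 ⟨?_, h1⟩), h2⟩
      rintro rfl
      exact hcol _ _ he h2.symm
  have h1 := Finset.card_le_card hsub'
  rw [Finset.card_insert_of_notMem (fun h => huM (Finset.mem_filter.1 h).1),
    hM.2.1.card_filter_coveredVerts col (fun x y h => hcol x y (hM.1 h)),
    hN.2.1.card_filter_coveredVerts col (fun x y h => hcol x y (hN.1 h)), hM.card_eq hN] at h1
  omega

/-- Deleting a suitable set of vertices leaves edges for which every vertex is missed by a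
maximum matching. -/
theorem exists_deletion [Fintype V] (H : Finset (Sym2 V)) (k : ℕ)
    (hk : ∀ M ⊆ H, IsMatch M → M.card ≤ k) :
    ∃ S : Finset V, (∃ M, IsMaxMatch (H.filter fun e => ∀ v ∈ S, v ∉ e) M ∧ M.card + S.card ≤ k) ∧
      ∀ v, ∃ N, IsMaxMatch (H.filter fun e => ∀ v ∈ S, v ∉ e) N ∧ v ∉ coveredVerts N := by
  classical
  let Pr : Finset V → Prop := fun S => ∀ M ⊆ H.filter (fun e => ∀ v ∈ S, v ∉ e), IsMatch M →
    M.card + S.card ≤ k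
  -- `S` is a largest set for which matching number after deletion plus `|S|` stays at most `k`. A
  -- vertex in every remaining maximum matching could be added, as its deletion lowers the matching
  -- number.
  obtain ⟨S, hS, hmax⟩ := (Finset.univ.filter Pr).exists_max_image Finset.card
    ⟨∅, by simpa [Pr] using hk⟩
  simp only [Finset.mem_filter, Finset.mem_univ, true_and] at hS hmax
  obtain ⟨M, hM⟩ := exists_isMaxMatch (H.filter fun e => ∀ v ∈ S, v ∉ e)
  refine ⟨S, ⟨M, hM, hS M hM.1 hM.2.1⟩, fun v => ?_⟩
  by_contra! hall
  have hvS : v ∉ S := by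
    intro hvS
    obtain ⟨e, he, hve⟩ := mem_coveredVerts.1 (hall M hM)
    exact (Finset.mem_filter.1 (hM.1 he)).2 v hvS hve
  have hPr : Pr (insert v S) := by
    intro M' hM' hmatch
    have hsub : M' ⊆ H.filter fun e => ∀ v ∈ S, v ∉ e := by
      intro e he
      obtain ⟨h1, h2⟩ := Finset.mem_filter.1 (hM' he)
      exact Finset.mem_filter.2 ⟨h1, fun w hw => h2 w (Finset.mem_insert_of_mem hw)⟩
    have hvM' : v ∉ coveredVerts M' := by
      intro h
      obtain ⟨e, he, hve⟩ := mem_coveredVerts.1 h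
      exact (Finset.mem_filter.1 (hM' he)).2 v (Finset.mem_insert_self _ _) hve
    have hlt : M'.card < M.card := by
      by_contra hge
      exact hvM' (hall M' ⟨hsub, hmatch, fun M'' h1 h2 => (hM.2.2 M'' h1 h2).trans (by omega)⟩)
    have := hS M hM.1 hM.2.1
    rw [Finset.card_insert_of_notMem hvS]
    omega
  have := hmax _ hPr
  rw [Finset.card_insert_of_notMem hvS] at this
  omega

/-- Few edges if there is no large matching: all but a few are covered by few vertices. -/
theorem exists_cover_of_matchings_le [Fintype V] (H : Finset (Sym2 V)) (k h : ℕ)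
    (hL : ∀ e ∈ H, ¬ e.IsDiag) (hk : ∀ M ⊆ H, IsMatch M → M.card ≤ k)
    (hor : 2 * k + 1 ≤ h ∨ ∃ col : V → Bool, ∀ x y, s(x, y) ∈ H → col x ≠ col y) :
    ∃ S : Finset V, S.card ≤ k ∧
      H.card ≤ ∑ v ∈ S, (H.filter fun e => v ∈ e).card + (k - S.card) * h := by
  obtain ⟨S, ⟨M, hM, hMS⟩, hmiss⟩ := exists_deletion H k hk
  refine ⟨S, by omega, ?_⟩
  have h1 : H ⊆ S.biUnion (fun v => H.filter fun e => v ∈ e) ∪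
      H.filter fun e => ∀ v ∈ S, v ∉ e := by
    intro e he
    by_cases h : ∀ v ∈ S, v ∉ e
    · exact Finset.mem_union_right _ (Finset.mem_filter.2 ⟨he, h⟩)
    · push Not at h
      obtain ⟨v, hv, hve⟩ := h
      exact Finset.mem_union_left _ (Finset.mem_biUnion.2 ⟨v, hv, Finset.mem_filter.2 ⟨he, hve⟩⟩)
  refine (Finset.card_le_card h1).trans ((Finset.card_union_le _ _).trans
    (add_le_add Finset.card_biUnion_le ?_))
  rcases hor with hh | ⟨col, hcol⟩
  · refine (hM.card_le (fun e he => hL e (Finset.mem_filter.1 he).1) hmiss).trans ?_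
    exact Nat.mul_le_mul (by omega) (by omega)
  · rw [eq_empty_of_bipartite_of_missed col (fun x y h => hcol x y (Finset.mem_filter.1 h).1) hmiss]
    simp

end Matchings

/-! ### Odd girth and bipartite edge sets. -/

namespace SimpleGraph

variable {V : Type*} {G : SimpleGraph V}

/-- An odd closed walk contains an odd cycle. -/
theorem Walk.exists_odd_isCycle : ∀ (n : ℕ) {u : V} (w : G.Walk u u), w.length = n →
    Odd w.length → ∃ (a : V) (c : G.Walk a a), c.IsCycle ∧ Odd c.length := by
  intro n
  induction n using Nat.strong_induction_on with
  | _ n ih =>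
    intro u w hn hodd
    cases w with
    | nil => simp at hodd
    | @cons _ x _ h p =>
      by_cases hp : p.IsPath
      · refine ⟨_, Walk.cons h p, ?_, hodd⟩
        rw [Walk.cons_isCycle_iff]
        refine ⟨hp, fun hmem => ?_⟩
        -- Running back along the first edge would make the closed walk have length 2.
        have := hp.length_eq_one_of_mem_edges (by rwa [Sym2.eq_swap])
        rw [Walk.length_cons, this] at hodd
        exact absurd hodd (by decide)
      -- A repeated vertex splits the walk into two shorter closed walks, one of which is odd.
      · obtain ⟨i, j, hij, hj, heq⟩ : ∃ i j, i < j ∧ j ≤ p.length ∧ p.getVert i = p.getVert j := by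
          by_contra! hall
          apply hp
          rw [← Walk.IsPath.getVert_injOn_iff]
          intro i hi j hj hij
          rcases lt_trichotomy i j with h | h | h
          · exact absurd hij (hall i j h hj)
          · exact h
          · exact absurd hij.symm (hall j i h hi)
        let c₁ : G.Walk (p.getVert i) (p.getVert i) :=
          ((p.drop i).take (j - i)).copy rfl (by
            rw [Walk.drop_getVert, Nat.add_sub_cancel' hij.le, heq])
        have hc₁ : c₁.length = j - i := by
          simp only [c₁, Walk.length_copy, Walk.take_length, Walk.drop_length]; omega
        let c₂ : G.Walk u u := Walk.cons h ((p.take i).append ((p.drop j).copy heq.symm rfl))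
        have hc₂ : c₂.length = i + (p.length - j) + 1 := by
          simp only [c₂, Walk.length_cons, Walk.length_append, Walk.length_copy, Walk.take_length,
            Walk.drop_length]; omega
        rw [Walk.length_cons] at hn hodd
        rcases Nat.even_or_odd (j - i) with he | ho
        · refine ih _ ?_ c₂ rfl ?_
          · rw [hc₂]; omega
          · rw [hc₂]
            rw [Nat.odd_iff] at hodd ⊢
            rw [Nat.even_iff] at he
            omega
        · exact ih _ (by rw [hc₁]; omega) c₁ rfl (by rw [hc₁]; exact ho)

theorem oddGirth_le_length {a : V} (c : G.Walk a a) (hc : c.IsCycle) (ho : Odd c.length) :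
    G.oddGirth ≤ c.length :=
  iInf_le_of_le a (iInf_le_of_le c (iInf_le_of_le hc (iInf_le _ ho)))

/-- Every other edge of a long cycle forms a matching. -/
theorem Walk.IsCycle.exists_isMatch {a : V} {c : G.Walk a a} (hc : c.IsCycle) {r : ℕ}
    (hr : 2 * r ≤ c.length) : ∃ M : Finset (Sym2 V), (∀ e ∈ M, e ∈ G.edgeSet) ∧ IsMatch M ∧
      M.card = r := by
  classical
  have hinj := hc.getVert_injOn'
  let f : ℕ → Sym2 V := fun i => s(c.getVert (2 * i), c.getVert (2 * i + 1))
  have key : ∀ i < r, ∀ j < r, ∀ v, v ∈ f i → v ∈ f j → i = j := by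
    intro i hi j hj v hvi hvj
    have : ∀ k, v ∈ f k → k < r → ∃ t, t / 2 = k ∧ t ≤ c.length - 1 ∧ v = c.getVert t := by
      intro k hk hkr
      rcases Sym2.mem_iff.1 hk with h | h
      · exact ⟨2 * k, by omega, by omega, h⟩
      · exact ⟨2 * k + 1, by omega, by omega, h⟩
    obtain ⟨t, ht, ht', h1⟩ := this i hvi hi
    obtain ⟨s, hs, hs', h2⟩ := this j hvj hj
    have := hinj ht' hs' (h1.symm.trans h2)
    omega
  refine ⟨(Finset.range r).image f, ?_, ?_, ?_⟩
  · intro e he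
    obtain ⟨i, hi, rfl⟩ := Finset.mem_image.1 he
    rw [Finset.mem_range] at hi
    exact c.adj_getVert_succ (by omega)
  · intro e he g hg v hve hvg
    obtain ⟨i, hi, rfl⟩ := Finset.mem_image.1 he
    obtain ⟨j, hj, rfl⟩ := Finset.mem_image.1 hg
    rw [key i (Finset.mem_range.1 hi) j (Finset.mem_range.1 hj) v hve hvg]
  · rw [Finset.card_image_of_injOn, Finset.card_range]
    intro i hi j hj hij
    refine key i (Finset.mem_range.1 hi) j (Finset.mem_range.1 hj) _ (Sym2.mem_mk_left _ _) ?_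
    rw [← hij]; exact Sym2.mem_mk_left _ _

/-- Edges without a matching of size `r`, in a graph of odd girth at least `2r`, are bipartite. -/
theorem exists_bicoloring_of_le_oddGirth (r : ℕ) (hg : ((2 * r : ℕ) : ℕ∞) ≤ G.oddGirth)
    (H : Finset (Sym2 V)) (hH : ∀ e ∈ H, e ∈ G.edgeSet)
    (hM : ∀ M ⊆ H, IsMatch M → M.card ≠ r) :
    ∃ col : V → Bool, ∀ x y, s(x, y) ∈ H → col x ≠ col y := by
  have hadj : ∀ x y, s(x, y) ∈ H → (fromEdgeSet (H : Set (Sym2 V))).Adj x y := by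
    intro x y hxy
    rw [fromEdgeSet_adj]
    exact ⟨hxy, G.ne_of_adj (hH _ hxy)⟩
  have hle : fromEdgeSet (H : Set (Sym2 V)) ≤ G := by
    intro x y hxy
    rw [fromEdgeSet_adj] at hxy
    exact hH _ hxy.1
  have h2 : (fromEdgeSet (H : Set (Sym2 V))).Colorable 2 := by
    rw [two_colorable_iff_forall_loop_even]
    intro u w
    by_contra hodd
    rw [Nat.not_even_iff_odd] at hodd
    obtain ⟨a, c, hc, ho⟩ := Walk.exists_odd_isCycle _ w rfl hodd
    have h1 := oddGirth_le_length (c.mapLe hle) (hc.mapLe hle) (by simpa using ho)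
    -- An odd cycle in `H` is long enough that every other edge yields a forbidden `r`-matching.
    have h2 : 2 * r ≤ c.length := by
      have := hg.trans h1
      rw [Nat.cast_le] at this
      simpa using this
    obtain ⟨M, h3, h4, h5⟩ := hc.exists_isMatch h2
    refine hM M (fun e he => ?_) h4 h5
    have := h3 e he
    rw [edgeSet_fromEdgeSet] at this
    exact this.1
  obtain ⟨C⟩ := h2
  refine ⟨fun v => finTwoEquiv (C v), fun x y hxy h => ?_⟩
  exact C.valid (hadj x y hxy) (finTwoEquiv.injective h)

end SimpleGraph

/-! ### The weight comparison. -/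

/-- Writing `(k - |S|) * h` as `k * h - |S| * h`, and likewise for `T`, with `k = |A|`, turns the
claim into a sum of inequalities at single vertices. At each vertex, `h` is at most half the degree
inside `A` and at least the rounded-up half outside. -/
theorem sum_weights_le {V : Type*} [Fintype V] [DecidableEq V] (A S T : Finset V) (k h : ℕ)
    (deg d e : V → ℕ) (hA : A.card = k) (hS : S.card ≤ k) (hT : T.card ≤ k)
    (hd : ∀ v, d v ≤ (deg v + 1) / 2) (he : ∀ v, e v ≤ (deg v + 1) / 2)
    (hde : ∀ v, d v + e v ≤ deg v) (hin : ∀ v ∈ A, h ≤ deg v / 2)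
    (hout : ∀ v ∉ A, (deg v + 1) / 2 ≤ h) :
    (∑ v ∈ S, d v + (k - S.card) * h) + (∑ v ∈ T, e v + (k - T.card) * h) ≤
      ∑ v ∈ A, deg v := by
  have key : ∀ v, (if v ∈ S then d v else 0) + (if v ∈ T then e v else 0) +
      2 * (if v ∈ A then h else 0) ≤ (if v ∈ A then deg v else 0) + (if v ∈ S then h else 0) +
      (if v ∈ T then h else 0) := by
    intro v
    have h1 := hd v
    have h2 := he v
    have h3 := hde v
    by_cases hvA : v ∈ A
    · have h4 := hin v hvA
      split_ifs <;> omega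
    · have h4 := hout v hvA
      split_ifs <;> omega
  have hsum := Finset.sum_le_sum fun v (_ : v ∈ Finset.univ) => key v
  simp only [Finset.sum_add_distrib, ← Finset.mul_sum, Finset.sum_ite_mem, Finset.univ_inter,
    Finset.sum_const, smul_eq_mul, hA] at hsum
  have e1 : (k - S.card) * h + S.card * h = k * h := by rw [← add_mul, Nat.sub_add_cancel hS]
  have e2 : (k - T.card) * h + T.card * h = k * h := by rw [← add_mul, Nat.sub_add_cancel hT]
  omega

/-! ### Edge orders from Euler tours. -/

namespace SimpleGraph

variable {V : Type*} {G : SimpleGraph V}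

theorem card_filter_mem_edgeFinset [Fintype V] [DecidableEq V] [DecidableRel G.Adj] (v : V) :
    (G.edgeFinset.filter fun e => v ∈ e).card = G.degree v := by
  rw [← G.card_incidenceFinset_eq_degree]
  congr 1
  ext e
  simp [incidenceSet]

section Positions

variable [DecidableEq V] {a : V} {p : G.Walk a a}

/-- The family of edges at the given positions of a walk. -/
def Walk.atPositions (p : G.Walk a a) (I : Finset (Fin p.edges.length)) (e : Sym2 V) : Bool :=
  decide (∃ i ∈ I, p.edges.get i = e)

theorem Walk.IsTrail.atPositions_get (hp : p.IsTrail) (I : Finset (Fin p.edges.length))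
    (i : Fin p.edges.length) : p.atPositions I (p.edges.get i) = true ↔ i ∈ I := by
  have hinj := List.nodup_iff_injective_get.1 hp.edges_nodup
  simp only [Walk.atPositions, decide_eq_true_eq]
  constructor
  · rintro ⟨j, hj, h⟩; rwa [← hinj h]
  · intro h; exact ⟨i, h, rfl⟩

theorem Walk.IsTrail.countP_atPositions (hp : p.IsTrail) (I : Finset (Fin p.edges.length))
    (v : V) : p.edges.countP (fun e => p.atPositions I e && decide (v ∈ e)) =
      (I.filter fun i => v ∈ p.edges.get i).card := by
  have hinj := List.nodup_iff_injective_get.1 hp.edges_nodup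
  rw [List.countP_eq_length_filter, ← List.toFinset_card_of_nodup (hp.edges_nodup.filter _),
    ← Finset.card_image_of_injective _ hinj]
  congr 1
  ext e
  simp only [List.mem_toFinset, List.mem_filter, Bool.and_eq_true, decide_eq_true_eq,
    Finset.mem_image, Finset.mem_filter]
  constructor
  · rintro ⟨h1, h2, h3⟩
    obtain ⟨i, rfl⟩ := List.get_of_mem h1
    exact ⟨i, ⟨(hp.atPositions_get I i).1 h2, h3⟩, rfl⟩
  · rintro ⟨i, ⟨h1, h2⟩, rfl⟩
    exact ⟨List.get_mem _ _, (hp.atPositions_get I i).2 h1, h2⟩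

theorem Walk.IsEulerian.countP_edges [Fintype V] [DecidableRel G.Adj] (hp : p.IsEulerian)
    (v : V) : p.edges.countP (fun e => decide (v ∈ e)) = G.degree v := by
  rw [List.countP_eq_length_filter,
    ← List.toFinset_card_of_nodup (hp.isTrail.edges_nodup.filter _), ← card_filter_mem_edgeFinset]
  congr 1
  ext e
  simp [hp.mem_edges_iff]

theorem Walk.IsTrail.isChain_atPositions (hp : p.IsTrail) (I : Finset (Fin p.edges.length))
    (hI : ∀ i ∈ I, ∀ j ∈ I, i.val + 1 ≠ j.val) :
    (p.edges.map (p.atPositions I)).IsChain fun x y => ¬ (x = true ∧ y = true) := by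
  rw [List.isChain_iff_getElem]
  intro i hi
  rw [List.getElem_map, List.getElem_map]
  simp only [List.length_map] at hi
  rintro ⟨h1, h2⟩
  exact hI _ ((hp.atPositions_get I ⟨i, by omega⟩).1 h1) _
    ((hp.atPositions_get I ⟨i + 1, hi⟩).1 h2) rfl

/-- Nonconsecutive positions of a closed Eulerian trail use at most half of the edges at a vertex
other than the base point. -/
theorem Walk.IsEulerian.two_mul_card_le_of_ne [Fintype V] [DecidableRel G.Adj]
    (hp : p.IsEulerian) (I : Finset (Fin p.edges.length))
    (hI : ∀ i ∈ I, ∀ j ∈ I, i.val + 1 ≠ j.val) {v : V} (hv : v ≠ a) :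
    2 * (I.filter fun i => v ∈ p.edges.get i).card ≤ G.degree v := by
  have h := p.two_mul_countP_le (p.atPositions I) v false
    (by
      have := hp.isTrail.isChain_atPositions I hI
      cases hl : p.edges.map (p.atPositions I) with
      | nil => simp
      | cons x l => rw [hl] at this; exact List.isChain_cons_cons.2 ⟨by simp, this⟩)
  rw [hp.isTrail.countP_atPositions, hp.countP_edges] at h
  simp only [if_neg hv.symm, add_zero] at h
  exact_mod_cast h

/-- Cyclically nonconsecutive positions of a closed Eulerian trail use at most half of the edges
at each vertex. -/
theorem Walk.IsEulerian.two_mul_card_le [Fintype V] [DecidableRel G.Adj]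
    (hp : p.IsEulerian) (I : Finset (Fin p.edges.length))
    (hI : ∀ i ∈ I, ∀ j ∈ I, i.val + 1 ≠ j.val)
    (hcyc : ∀ i ∈ I, ∀ j ∈ I, i.val = 0 → j.val + 1 ≠ p.edges.length) (v : V) :
    2 * (I.filter fun i => v ∈ p.edges.get i).card ≤ G.degree v := by
  have hchain := hp.isTrail.isChain_atPositions I hI
  set l := p.edges.map (p.atPositions I) with hl
  have hlen : l.length = p.edges.length := by simp [hl]
  -- The imaginary edge before the start is the last edge of the tour, so the two boundary terms at
  -- the base point cancel.
  have h := p.two_mul_countP_le (p.atPositions I) v (l.getLastD false)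
    (by
      rw [← hl, List.isChain_cons]
      refine ⟨fun y hy => ?_, hchain⟩
      rintro ⟨h1, h2⟩
      subst h2
      obtain ⟨h0, h0'⟩ : ∃ h : 0 < l.length, l[0] = true := by
        rw [List.head?_eq_getElem?] at hy
        exact List.getElem?_eq_some_iff.1 hy
      have hne : l ≠ [] := List.ne_nil_of_length_pos h0
      rw [List.getLastD_eq_getLast?, List.getLast?_eq_some_getLast hne, Option.getD_some,
        List.getLast_eq_getElem] at h1
      have e0 : (⟨0, hlen ▸ h0⟩ : Fin p.edges.length) ∈ I := by
        rw [← hp.isTrail.atPositions_get]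
        simpa [hl] using h0'
      have e1 : (⟨l.length - 1, by omega⟩ : Fin p.edges.length) ∈ I := by
        rw [← hp.isTrail.atPositions_get]
        simpa [hl] using h1
      exact hcyc _ e0 _ e1 rfl (by dsimp only; omega))
  rw [hp.isTrail.countP_atPositions, hp.countP_edges, ← hl] at h
  have : ∀ l : List Bool, l.getLastD (l.getLastD false) = l.getLastD false := by
    rintro (_ | ⟨x, l⟩)
    · rfl
    · simp only [List.getLastD_cons]
  rw [this] at h
  have := (add_le_add_iff_right _).1 h
  exact_mod_cast this

end Positions

/-- The extension by a new vertex joined to all vertices of odd degree. -/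
def oddExtension (G : SimpleGraph V) [G.LocallyFinite] : SimpleGraph (Option V) where
  Adj x y := match x, y with
    | some x, some y => G.Adj x y
    | some x, none => Odd (G.degree x)
    | none, some y => Odd (G.degree y)
    | none, none => False
  symm := ⟨fun x y h => by
    cases x <;> cases y <;> simp_all [G.adj_comm]⟩
  loopless := ⟨fun x h => by cases x <;> simp_all⟩

end SimpleGraph

namespace SimpleGraph

variable {V : Type*} {G : SimpleGraph V}

section OddExtension

variable [Fintype V] [DecidableRel G.Adj]

theorem degree_oddExtension_some [DecidableRel G.oddExtension.Adj] (x : V) :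
    G.oddExtension.degree (some x) = G.degree x + if Odd (G.degree x) then 1 else 0 := by
  classical
  have : G.oddExtension.neighborFinset (some x) =
      (G.neighborFinset x).map Function.Embedding.some ∪
        if Odd (G.degree x) then {none} else ∅ := by
    ext y
    rw [mem_neighborFinset]
    cases y with
    | none => split_ifs with h <;> simp [oddExtension, h]
    | some y => split_ifs with h <;> simp [oddExtension]
  rw [← card_neighborFinset_eq_degree, this, Finset.card_union_of_disjoint, Finset.card_map,
    card_neighborFinset_eq_degree]
  · split_ifs <;> simp
  · split_ifs <;> simp

theorem degree_oddExtension_none [DecidableRel G.oddExtension.Adj] :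
    G.oddExtension.degree none = (Finset.univ.filter fun v => Odd (G.degree v)).card := by
  classical
  have : G.oddExtension.neighborFinset none =
      (Finset.univ.filter fun v => Odd (G.degree v)).map Function.Embedding.some := by
    ext y
    rw [mem_neighborFinset]
    cases y with
    | none => simp [oddExtension]
    | some y => simp [oddExtension]
  rw [← card_neighborFinset_eq_degree, this, Finset.card_map]

theorem even_degree_oddExtension [DecidableRel G.oddExtension.Adj] (x : Option V) :
    Even (G.oddExtension.degree x) := by
  cases x with
  | none => rw [degree_oddExtension_none]; exact G.even_card_odd_degree_vertices
  | some x =>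
    rw [degree_oddExtension_some]
    split_ifs with h
    · exact h.add_one
    · simpa using h

theorem Connected.oddExtension (hG : G.Connected) {v : V} (hv : Odd (G.degree v)) :
    G.oddExtension.Connected := by
  let φ : G →g G.oddExtension := ⟨some, fun h => h⟩
  have h0 : ∀ x, G.oddExtension.Reachable x (some v) := by
    intro x
    cases x with
    | none => exact Adj.reachable (show Odd (G.degree v) from hv)
    | some x => exact (hG.preconnected x v).map φ
  exact ⟨fun x y => (h0 x).trans (h0 y).symm⟩

end OddExtension

/-- An order of the edges of a connected graph with a vertex of odd degree in which nonconsecutive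
positions use about half of the edges at each vertex. -/
theorem Connected.exists_edge_order_of_odd [Fintype V] [DecidableEq V] [DecidableRel G.Adj]
    (hG : G.Connected) {v₀ : V} (hv₀ : Odd (G.degree v₀)) :
    ∃ (N : ℕ) (e : Fin N → Sym2 V), Function.Injective e ∧
      Finset.univ.image e = G.edgeFinset ∧
      ∀ I : Finset (Fin N), (∀ i ∈ I, ∀ j ∈ I, i.val + 1 ≠ j.val) →
        ∀ v, (I.filter fun i => v ∈ e i).card ≤ (G.degree v + 1) / 2 := by
  classical
  -- With the base point at the new vertex, no vertex of `G` needs the cyclic condition.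
  obtain ⟨p, hp⟩ := (hG.oddExtension hv₀).exists_isEulerian even_degree_oddExtension none
  have hinj := List.nodup_iff_injective_get.1 hp.isTrail.edges_nodup
  have hmapinj : Function.Injective (Sym2.map (some : V → Option V)) :=
    Sym2.map.injective (Option.some_injective V)
  have hmem : ∀ e : Sym2 V, e ∈ G.edgeSet ↔ e.map some ∈ p.edges := by
    intro e
    rw [hp.mem_edges_iff]
    refine Sym2.ind (fun x y => ?_) e
    rfl
  let J : Finset (Fin p.edges.length) :=
    Finset.univ.filter fun k => ∃ e ∈ G.edgeSet, p.edges.get k = e.map some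
  let ι : Fin J.card ↪o Fin p.edges.length := J.orderEmbOfFin rfl
  have hι : ∀ k, ∃ e ∈ G.edgeSet, p.edges.get (ι k) = e.map some := fun k =>
    (Finset.mem_filter.1 (J.orderEmbOfFin_mem rfl k)).2
  choose e he hpe using hι
  refine ⟨J.card, e, ?_, ?_, ?_⟩
  · intro i j hij
    apply ι.injective
    apply hinj
    rw [hpe, hpe, hij]
  · ext x
    simp only [Finset.mem_image, Finset.mem_univ, true_and, mem_edgeFinset]
    constructor
    · rintro ⟨k, rfl⟩; exact he k
    · intro hx
      obtain ⟨k, hk⟩ := List.get_of_mem ((hmem x).1 hx)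
      have hkJ : k ∈ J := Finset.mem_filter.2 ⟨Finset.mem_univ _, x, hx, hk⟩
      have : k ∈ Set.range ι := by
        rw [Finset.range_orderEmbOfFin]; exact hkJ
      obtain ⟨i, rfl⟩ := this
      exact ⟨i, hmapinj (by rw [← hpe, hk])⟩
  · intro I hI v
    -- Two edges of `G` consecutive in the tour stay consecutive after the auxiliary edges are
    -- removed.
    have h := hp.two_mul_card_le_of_ne (I.map ι.toEmbedding) (v := some v) (by
      intro i hi j hj hij
      obtain ⟨i, hi', rfl⟩ := Finset.mem_map.1 hi
      obtain ⟨j, hj', rfl⟩ := Finset.mem_map.1 hj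
      simp only [RelEmbedding.coe_toEmbedding] at hij
      have hlt : i < j := by
        rw [← ι.lt_iff_lt, Fin.lt_def]; omega
      have hij' : i.val + 1 ≤ j.val := hlt
      rcases hij'.eq_or_lt with h | h
      · exact hI i hi' j hj' h
      · have h1 : i < (⟨i.val + 1, by omega⟩ : Fin J.card) := by rw [Fin.lt_def]; simp
        have h2 : (⟨i.val + 1, by omega⟩ : Fin J.card) < j := h
        rw [← ι.lt_iff_lt, Fin.lt_def] at h1 h2
        omega) (by simp)
    rw [Finset.filter_map, Finset.card_map] at h
    have h2 : (I.filter fun i => v ∈ e i) ⊆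
        I.filter ((fun i => some v ∈ p.edges.get i) ∘ ι.toEmbedding) := by
      intro i hi
      rw [Finset.mem_filter] at hi ⊢
      refine ⟨hi.1, ?_⟩
      simp only [Function.comp_apply, RelEmbedding.coe_toEmbedding]
      rw [hpe, Sym2.mem_map]
      exact ⟨v, hi.2, rfl⟩
    have h3 := Finset.card_le_card h2
    rw [degree_oddExtension_some] at h
    split_ifs at h <;> omega

/-- A cyclic order of the edges of a connected graph with even degrees in which cyclically
nonconsecutive positions use at most half of the edges at each vertex. -/
theorem Connected.exists_edge_order_of_even [Fintype V] [DecidableEq V] [DecidableRel G.Adj]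
    (hG : G.Connected) (heven : ∀ v, Even (G.degree v)) :
    ∃ (N : ℕ) (e : Fin N → Sym2 V), Function.Injective e ∧
      Finset.univ.image e = G.edgeFinset ∧
      ∀ I : Finset (Fin N), (∀ i ∈ I, ∀ j ∈ I, i.val + 1 ≠ j.val) →
        (∀ i ∈ I, ∀ j ∈ I, i.val = 0 → j.val + 1 ≠ N) →
        ∀ v, 2 * (I.filter fun i => v ∈ e i).card ≤ G.degree v := by
  obtain ⟨a⟩ := hG.nonempty
  obtain ⟨p, hp⟩ := hG.exists_isEulerian heven a
  refine ⟨p.edges.length, p.edges.get, List.nodup_iff_injective_get.1 hp.isTrail.edges_nodup,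
    ?_, fun I hI hcyc => hp.two_mul_card_le I hI hcyc⟩
  ext x
  rw [mem_edgeFinset, ← hp.mem_edges_iff, List.mem_iff_get]
  simp only [Finset.mem_image, Finset.mem_univ, true_and]

end SimpleGraph

/-! ### The two parity classes of an alternating subsequence. -/

section AlternatingPositions

variable {K N : ℕ}

/-- The positions of a sequence whose index has the given parity. -/
def parityPositions (f : Fin K → Fin N) (q : ℕ) : Finset (Fin N) :=
  (Finset.univ.filter fun i : Fin K => i.val % 2 = q).image f

theorem mem_parityPositions {f : Fin K → Fin N} {q : ℕ} {k : Fin N} :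
    k ∈ parityPositions f q ↔ ∃ i : Fin K, i.val % 2 = q ∧ f i = k := by
  simp [parityPositions]

theorem parityPositions_nonconsecutive {f : Fin K → Fin N} (hf : StrictMono f) (q : ℕ) :
    ∀ i ∈ parityPositions f q, ∀ j ∈ parityPositions f q, i.val + 1 ≠ j.val := by
  intro i hi j hj hij
  obtain ⟨i, hi, rfl⟩ := mem_parityPositions.1 hi
  obtain ⟨j, hj, rfl⟩ := mem_parityPositions.1 hj
  have hlt : i < j := by rw [← hf.lt_iff_lt, Fin.lt_def]; omega
  rw [Fin.lt_def] at hlt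
  have h1 : i < (⟨i.val + 1, by omega⟩ : Fin K) := by rw [Fin.lt_def]; simp
  have h2 : (⟨i.val + 1, by omega⟩ : Fin K) < j := by rw [Fin.lt_def]; simp only; omega
  have h1 := hf h1
  have h2 := hf h2
  rw [Fin.lt_def] at h1 h2
  omega

/-- Positions `0` and `N - 1` can only be the first and last terms, whose indices `0` and `K - 1`
have different parity. -/
theorem parityPositions_cyclic {f : Fin K → Fin N} (hf : StrictMono f) (hK : Even K) (q : ℕ) :
    ∀ i ∈ parityPositions f q, ∀ j ∈ parityPositions f q, i.val = 0 → j.val + 1 ≠ N := by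
  intro i hi j hj hi0 hjN
  obtain ⟨i, hi, rfl⟩ := mem_parityPositions.1 hi
  obtain ⟨j, hj, rfl⟩ := mem_parityPositions.1 hj
  rw [Nat.even_iff] at hK
  have hi' : i.val = 0 := by
    by_contra hne
    have := hf (show (⟨0, by omega⟩ : Fin K) < i by rw [Fin.lt_def]; simp only; omega)
    rw [Fin.lt_def] at this
    omega
  have hj' : j.val + 1 = K := by
    by_contra hne
    have := hf (show j < (⟨j.val + 1, by omega⟩ : Fin K) by rw [Fin.lt_def]; simp)
    rw [Fin.lt_def] at this
    omega
  omega

theorem card_parityPositions_add {f : Fin K → Fin N} (hf : StrictMono f) :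
    (parityPositions f 0).card + (parityPositions f 1).card = K := by
  rw [parityPositions, parityPositions, Finset.card_image_of_injective _ hf.injective,
    Finset.card_image_of_injective _ hf.injective]
  have : (Finset.univ.filter fun i : Fin K => i.val % 2 = 1) =
      Finset.univ.filter fun i : Fin K => ¬ i.val % 2 = 0 := by
    ext i; simp
  rw [this, Finset.card_filter_add_card_filter_not]
  simp

theorem le_card_parityPositions {m : ℕ} {f : Fin K → Fin N} (hf : StrictMono f)
    (hK : 2 * m ≤ K) {q : ℕ} (hq : q < 2) : m ≤ (parityPositions f q).card := by
  rw [parityPositions, Finset.card_image_of_injective _ hf.injective]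
  have := Finset.card_le_card_of_injOn (s := (Finset.univ : Finset (Fin m)))
    (t := Finset.univ.filter fun i : Fin K => i.val % 2 = q)
    (fun i => ⟨2 * i.val + q, by omega⟩) (by intro i _; simp; omega)
    (by intro i _ j _ h; simp only [Fin.mk.injEq] at h; ext; omega)
  simpa using this

theorem disjoint_parityPositions {f : Fin K → Fin N} (hf : StrictMono f) :
    Disjoint (parityPositions f 0) (parityPositions f 1) := by
  rw [Finset.disjoint_left]
  intro k h0 h1
  obtain ⟨i, hi, rfl⟩ := mem_parityPositions.1 h0
  obtain ⟨j, hj, h⟩ := mem_parityPositions.1 h1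
  rw [hf.injective h] at hj
  omega

theorem sign_parityPositions {x : Fin N → SignType} {f : Fin K → Fin N} {b : Bool}
    (hx : ∀ i, x (f i) = (-1) ^ i.val * boolSign b) :
    (∀ k ∈ parityPositions f 0, x k = boolSign b) ∧
      ∀ k ∈ parityPositions f 1, x k = boolSign (!b) := by
  constructor <;> intro k hk <;> obtain ⟨i, hi, rfl⟩ := mem_parityPositions.1 hk
  · rw [hx, Even.neg_one_pow (Nat.even_iff.2 hi), one_mul]
  · rw [hx, Odd.neg_one_pow (Nat.odd_iff.2 hi), boolSign_not, neg_one_mul]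

end AlternatingPositions

/-! ### The lower bound for the number of colours. -/

namespace SimpleGraph

variable {V : Type*} {G : SimpleGraph V} [Fintype V] [DecidableEq V] [DecidableRel G.Adj]

/-- The lower bound for colourings of `r`-matchings, from few-edges covers. -/
theorem Connected.card_edgeFinset_le (hG : G.Connected) (r h C : ℕ) (A : Finset V)
    (hA : A.card = r - 1) (hin : ∀ v ∈ A, h ≤ G.degree v / 2)
    (hout : ∀ v ∉ A, (G.degree v + 1) / 2 ≤ h)
    (hcover : ∀ H ⊆ G.edgeFinset, (∀ M ⊆ H, IsMatch M → M.card ≠ r) →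
      ∃ S : Finset V, S.card ≤ r - 1 ∧
        H.card ≤ ∑ v ∈ S, (H.filter fun e => v ∈ e).card + (r - 1 - S.card) * h)
    (c : Finset (Sym2 V) → ℕ)
    (hC : ∀ M ⊆ G.edgeFinset, IsMatch M → M.card = r → c M < C)
    (hc : ∀ M ⊆ G.edgeFinset, IsMatch M → M.card = r → ∀ M' ⊆ G.edgeFinset, IsMatch M' →
      M'.card = r → Disjoint M M' → c M ≠ c M') :
    G.edgeFinset.card ≤ ∑ v ∈ A, G.degree v + C := by
  classical
  let ι := {M : Finset (Sym2 V) // M ⊆ G.edgeFinset ∧ IsMatch M ∧ M.card = r}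
  have hdegle : ∀ (H₀ H₁ : Finset (Sym2 V)), H₀ ⊆ G.edgeFinset → H₁ ⊆ G.edgeFinset →
      Disjoint H₀ H₁ → ∀ v, (H₀.filter fun e => v ∈ e).card + (H₁.filter fun e => v ∈ e).card ≤
        G.degree v := by
    intro H₀ H₁ h0 h1 hd v
    rw [← card_filter_mem_edgeFinset, ← Finset.card_union_of_disjoint
      (Finset.disjoint_filter_filter hd), ← Finset.filter_union]
    exact Finset.card_le_card (Finset.filter_subset_filter _ (Finset.union_subset h0 h1))
  have general : ∀ {N : ℕ} (e : Fin N → Sym2 V), Function.Injective e →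
      Finset.univ.image e = G.edgeFinset →
      ∃ S : ι → Finset (Fin N), (∀ i j, Disjoint (S i) (S j) → c i.1 ≠ c j.1) ∧
        (N = G.edgeFinset.card) ∧ (∀ I : Finset (Fin N), I.image e ⊆ G.edgeFinset) ∧
        (∀ (I : Finset (Fin N)) v, ((I.image e).filter fun e => v ∈ e).card =
          (I.filter fun i => v ∈ e i).card) ∧
        ∀ (x : Fin N → SignType) (b : Bool) (I : Finset (Fin N)),
          (∀ k ∈ I, x k = boolSign b) → ∀ M : ι, M.1 ⊆ I.image e →
          ColorAt S (fun i => c i.1) x b (c M.1) := by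
    intro N e hinj himg
    refine ⟨fun M => Finset.univ.filter fun k => e k ∈ M.1, ?_, ?_, ?_, ?_, ?_⟩
    · intro M M' hd
      refine hc _ M.2.1 M.2.2.1 M.2.2.2 _ M'.2.1 M'.2.2.1 M'.2.2.2 ?_
      rw [Finset.disjoint_left] at hd ⊢
      intro x hx hx'
      have := M.2.1 hx
      rw [← himg] at this
      obtain ⟨k, -, rfl⟩ := Finset.mem_image.1 this
      exact hd (a := k) (by simpa using hx) (by simpa using hx')
    · rw [← himg, Finset.card_image_of_injective _ hinj]; simp
    · intro I; rw [← himg]; exact Finset.image_subset_image (Finset.subset_univ _)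
    · intro I v
      rw [Finset.filter_image, Finset.card_image_of_injective _ hinj]
    · intro x b I hx M hM
      refine ⟨M, fun k hk => hx k ?_, rfl⟩
      obtain ⟨j, hj, hjk⟩ := Finset.mem_image.1 (hM (Finset.mem_filter.1 hk).2)
      rwa [← hinj hjk]
  have hmat : ∀ H ⊆ G.edgeFinset, ¬ (∀ M ⊆ H, IsMatch M → M.card ≠ r) → ∃ M : ι, M.1 ⊆ H := by
    intro H hH hn
    push Not at hn
    obtain ⟨M, h1, h2, h3⟩ := hn
    exact ⟨⟨M, h1.trans hH, h2, h3⟩, h1⟩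
  by_cases hodd : ∃ v, Odd (G.degree v)
  · obtain ⟨v₀, hv₀⟩ := hodd
    obtain ⟨N, e, hinj, himg, horder⟩ := hG.exists_edge_order_of_odd hv₀
    obtain ⟨S, hS, hN, hsub, hcount, hcol⟩ := general e hinj himg
    -- The two classes have `∑ v ∈ A, deg v + 1` edges in all; if neither contained an `r`-matching,
    -- the covers would bound this by `∑ v ∈ A, deg v`.
    have := le_add_of_altSeq (α := ∑ v ∈ A, G.degree v) (s := 0) S (fun i => c i.1)
      (fun i => hC _ i.2.1 i.2.2.1 i.2.2.2) hS (by
        rintro x ⟨b, f, hf, hx⟩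
        obtain ⟨hx0, hx1⟩ := sign_parityPositions hx
        by_cases hn0 : ∀ M ⊆ (parityPositions f 0).image e, IsMatch M → M.card ≠ r
        · by_cases hn1 : ∀ M ⊆ (parityPositions f 1).image e, IsMatch M → M.card ≠ r
          · exfalso
            obtain ⟨S₀, hS₀, hle₀⟩ := hcover _ (hsub _) hn0
            obtain ⟨S₁, hS₁, hle₁⟩ := hcover _ (hsub _) hn1
            have hw := sum_weights_le A S₀ S₁ (r - 1) h (fun v => G.degree v) _ _ hA hS₀ hS₁
              (fun v => by
                rw [hcount]
                exact horder _ (parityPositions_nonconsecutive hf 0) v)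
              (fun v => by
                rw [hcount]
                exact horder _ (parityPositions_nonconsecutive hf 1) v)
              (hdegle _ _ (hsub _) (hsub _) ((Finset.disjoint_image hinj).2
                (disjoint_parityPositions hf))) hin hout
            have hcard := card_parityPositions_add hf
            rw [Finset.card_image_of_injective _ hinj] at hle₀ hle₁
            omega
          · obtain ⟨M, hM⟩ := hmat _ (hsub _) hn1
            exact ⟨_, _, Nat.zero_le _, hcol x _ _ hx1 M hM⟩
        · obtain ⟨M, hM⟩ := hmat _ (hsub _) hn0
          exact ⟨_, _, Nat.zero_le _, hcol x _ _ hx0 M hM⟩)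
    omega
  · have heven : ∀ v, Even (G.degree v) := by
      intro v; rw [← Nat.not_odd_iff_even]; exact fun h => hodd ⟨v, h⟩
    obtain ⟨m, hm⟩ : Even (∑ v ∈ A, G.degree v) := Finset.even_sum _ fun v _ => heven v
    -- The truncated `C - 1` below would lose a unit at `C = 0`; there no `r`-matching exists and
    -- the cover of the whole edge set suffices.
    by_cases hC0 : C = 0
    · obtain ⟨S, hS, hle⟩ := hcover _ subset_rfl fun M h1 h2 h3 => by
        have := hC M h1 h2 h3; omega
      have hw := sum_weights_le A S S (r - 1) h (fun v => G.degree v) (fun v => G.degree v / 2)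
        (fun v => G.degree v / 2) hA hS hS (fun v => by omega) (fun v => by omega)
        (fun v => by omega) hin hout
      have : ∑ v ∈ S, (G.edgeFinset.filter fun e => v ∈ e).card =
          ∑ v ∈ S, G.degree v / 2 + ∑ v ∈ S, G.degree v / 2 := by
        rw [← Finset.sum_add_distrib]
        refine Finset.sum_congr rfl fun v _ => ?_
        rw [card_filter_mem_edgeFinset]
        obtain ⟨d, hd⟩ := heven v
        omega
      omega
    obtain ⟨N, e, hinj, himg, horder⟩ := hG.exists_edge_order_of_even heven
    obtain ⟨S, hS, hN, hsub, hcount, hcol⟩ := general e hinj himg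
    -- The length `∑ v ∈ A, deg v + 2` is even, as the cyclic condition requires. Each class has one
    -- edge more than half of the degree sum, so each contains an `r`-matching; these are disjoint,
    -- so one has a nonzero colour.
    have := le_add_of_altSeq (α := ∑ v ∈ A, G.degree v + 1) (s := 1) S (fun i => c i.1)
      (fun i => hC _ i.2.1 i.2.2.1 i.2.2.2) hS (by
        rintro x ⟨b, f, hf, hx⟩
        obtain ⟨hx0, hx1⟩ := sign_parityPositions hx
        have hK : Even (∑ v ∈ A, G.degree v + 1 + 1) := ⟨m + 1, by omega⟩
        have hex : ∀ q < 2, ∃ M : ι, M.1 ⊆ (parityPositions f q).image e := by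
          intro q hq
          refine hmat _ (hsub _) fun hn => ?_
          obtain ⟨S₀, hS₀, hle₀⟩ := hcover _ (hsub _) hn
          have hhalf : ∀ v, 2 * (((parityPositions f q).image e).filter fun e => v ∈ e).card ≤
              G.degree v := fun v => by
            rw [hcount]
            exact horder _ (parityPositions_nonconsecutive hf q)
              (parityPositions_cyclic hf hK q) v
          have hw := sum_weights_le A S₀ S₀ (r - 1) h (fun v => G.degree v)
            (fun v => (((parityPositions f q).image e).filter fun e => v ∈ e).card)
            (fun v => (((parityPositions f q).image e).filter fun e => v ∈ e).card) hA hS₀ hS₀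
            (fun v => by have := hhalf v; omega) (fun v => by have := hhalf v; omega)
            (fun v => by have := hhalf v; omega) hin hout
          have hcard := le_card_parityPositions (m := m + 1) hf (by omega) hq
          rw [Finset.card_image_of_injective _ hinj] at hle₀
          omega
        obtain ⟨M₀, hM₀⟩ := hex 0 (by norm_num)
        obtain ⟨M₁, hM₁⟩ := hex 1 (by norm_num)
        have hne : c M₀.1 ≠ c M₁.1 := hc _ M₀.2.1 M₀.2.2.1 M₀.2.2.2 _ M₁.2.1 M₁.2.2.1 M₁.2.2.2
          (Finset.disjoint_of_subset_left hM₀ (Finset.disjoint_of_subset_right hM₁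
            ((Finset.disjoint_image hinj).2 (disjoint_parityPositions hf))))
        by_cases h0 : c M₀.1 = 0
        · exact ⟨_, _, by omega, hcol x _ _ hx1 M₁ hM₁⟩
        · exact ⟨_, _, by omega, hcol x _ _ hx0 M₀ hM₀⟩)
    omega

end SimpleGraph

/-! ### Copies of `rK₂` as matchings, and the upper bound. -/

namespace SimpleGraph

variable {V : Type*} {G : SimpleGraph V}

/-- The edges of a copy of `rK₂` form a matching of size `r`. -/
theorem exists_isMatch_of_iso [DecidableEq V] {r : ℕ} {K : G.Subgraph} (φ : K.coe ≃g matchingGraph r) :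
    ∃ M : Finset (Sym2 V), (M : Set (Sym2 V)) = K.edgeSet ∧ IsMatch M ∧ M.card = r := by
  let f : Fin r × Fin 2 → V := fun x => (φ.symm x).1
  have hf : Function.Injective f := fun x y h => φ.symm.injective (Subtype.ext h)
  let m : Fin r → Sym2 V := fun i => s(f (i, 0), f (i, 1))
  have key : ∀ i j v, v ∈ m i → v ∈ m j → i = j := by
    intro i j v hi hj
    rcases Sym2.mem_iff.1 hi with h | h <;> rcases Sym2.mem_iff.1 hj with h' | h' <;>
      exact (Prod.ext_iff.1 (hf (h.symm.trans h'))).1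
  refine ⟨Finset.univ.image m, ?_, ?_, ?_⟩
  · ext e
    refine Sym2.ind (fun a b => ?_) e
    simp only [Finset.coe_image, Finset.coe_univ, Set.image_univ, Set.mem_range,
      Subgraph.mem_edgeSet]
    constructor
    · rintro ⟨i, hi⟩
      have : K.Adj (f (i, 0)) (f (i, 1)) :=
        φ.symm.map_rel_iff.2 (show (matchingGraph r).Adj (i, 0) (i, 1) from ⟨rfl, by simp⟩)
      rcases Sym2.eq_iff.1 hi with ⟨rfl, rfl⟩ | ⟨rfl, rfl⟩
      · exact this
      · exact this.symm
    · intro hab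
      let a' : K.verts := ⟨a, K.edge_vert hab⟩
      let b' : K.verts := ⟨b, K.edge_vert hab.symm⟩
      have hab' : (matchingGraph r).Adj (φ a') (φ b') := φ.map_rel_iff.2 hab
      have ha : f (φ a') = a := by simp [f, a']
      have hb : f (φ b') = b := by simp [f, b']
      obtain ⟨h1, h2⟩ := hab'
      rcases hx : φ a' with ⟨i, p⟩
      rcases hy : φ b' with ⟨j, q⟩
      rw [hx] at ha h1 h2
      rw [hy] at hb h1 h2
      dsimp only at h1 h2
      subst h1
      refine ⟨i, ?_⟩
      rw [← ha, ← hb, Sym2.eq_iff]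
      have : (p = 0 ∧ q = 1) ∨ (p = 1 ∧ q = 0) := by omega
      rcases this with ⟨rfl, rfl⟩ | ⟨rfl, rfl⟩
      · exact Or.inl ⟨rfl, rfl⟩
      · exact Or.inr ⟨rfl, rfl⟩
  · intro e he g hg v hve hvg
    obtain ⟨i, -, rfl⟩ := Finset.mem_image.1 he
    obtain ⟨j, -, rfl⟩ := Finset.mem_image.1 hg
    rw [key i j v hve hvg]
  · rw [Finset.card_image_of_injective]
    · simp
    · intro i j hij
      exact key i j (f (i, 0)) (Sym2.mem_mk_left _ _) (hij ▸ Sym2.mem_mk_left _ _)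

/-- A matching of size `r` is the edge set of a copy of `rK₂`. -/
theorem exists_iso_of_isMatch {r : ℕ} {M : Finset (Sym2 V)} (hM : ∀ e ∈ M, e ∈ G.edgeSet)
    (hmatch : IsMatch M) (hr : M.card = r) :
    ∃ K : G.Subgraph, Nonempty (K.coe ≃g matchingGraph r) ∧ K.edgeSet = M := by
  let m : Fin r ≃ M := (M.equivFinOfCardEq hr).symm
  let f : Fin r × Fin 2 → V := fun x => if x.2 = 0 then (m x.1).1.out.1 else (m x.1).1.out.2
  have hm : ∀ i, s(f (i, 0), f (i, 1)) = (m i).1 := fun i => by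
    simp only [f, if_true, one_ne_zero, if_false]
    exact Quot.out_eq (m i).1
  have hadj : ∀ i, G.Adj (f (i, 0)) (f (i, 1)) := fun i => by
    rw [← mem_edgeSet, hm]; exact hM _ (m i).2
  have hmem : ∀ x, f x ∈ (m x.1).1 := by
    rintro ⟨i, p⟩
    rw [← hm]
    have : p = 0 ∨ p = 1 := by omega
    rcases this with rfl | rfl <;> simp
  have hf : Function.Injective f := by
    rintro ⟨i, p⟩ ⟨j, q⟩ h
    have hij : i = j := m.injective (Subtype.ext
      (hmatch _ (m i).2 _ (m j).2 _ (hmem (i, p)) (h ▸ hmem (j, q))))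
    subst hij
    have hne := (hadj i).ne
    by_contra hpq
    have : (p = 0 ∧ q = 1) ∨ (p = 1 ∧ q = 0) := by
      have : p ≠ q := fun h => hpq (by rw [h])
      omega
    rcases this with ⟨rfl, rfl⟩ | ⟨rfl, rfl⟩
    · exact hne h
    · exact hne h.symm
  let φ : matchingGraph r →g G := ⟨f, by
    rintro ⟨i, p⟩ ⟨j, q⟩ ⟨h1, h2⟩
    dsimp only at h1 h2
    subst h1
    have : (p = 0 ∧ q = 1) ∨ (p = 1 ∧ q = 0) := by omega
    rcases this with ⟨rfl, rfl⟩ | ⟨rfl, rfl⟩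
    · exact hadj i
    · exact (hadj i).symm⟩
  refine ⟨(φ.toCopy hf).toSubgraph, ⟨(φ.toCopy hf).isoToSubgraph.symm⟩, ?_⟩
  rw [Copy.toSubgraph, Subgraph.edgeSet_map, Subgraph.edgeSet_top]
  ext e
  constructor
  · rintro ⟨d, hd, rfl⟩
    revert hd
    refine Sym2.ind (fun x y => ?_) d
    rintro ⟨h1, h2⟩
    obtain ⟨i, p⟩ := x
    obtain ⟨j, q⟩ := y
    dsimp only at h1 h2
    subst h1
    have : (p = 0 ∧ q = 1) ∨ (p = 1 ∧ q = 0) := by omega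
    have hi := (m i).2
    rw [← hm] at hi
    rcases this with ⟨rfl, rfl⟩ | ⟨rfl, rfl⟩
    · exact hi
    · rw [Sym2.eq_swap] at hi; exact hi
  · intro he
    obtain ⟨i, hi⟩ := m.surjective ⟨e, he⟩
    refine ⟨s((i, 0), (i, 1)), ⟨rfl, by simp⟩, ?_⟩
    have := hm i
    rw [hi] at this
    exact this

variable [Fintype V] [DecidableEq V] [DecidableRel G.Adj]

/-- Edges outside an independent set. -/
theorem card_filter_avoid_add_sum_degree {A : Finset V} (hA : G.IsIndepSet A) :
    (G.edgeFinset.filter fun e => ∀ v ∈ A, v ∉ e).card + ∑ v ∈ A, G.degree v =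
      G.edgeFinset.card := by
  have h1 : (G.edgeFinset.filter fun e => ¬ ∀ v ∈ A, v ∉ e) =
      A.biUnion fun v => G.edgeFinset.filter fun e => v ∈ e := by
    ext e
    simp only [Finset.mem_filter, Finset.mem_biUnion, not_forall, not_not]
    constructor
    · rintro ⟨h, v, hv, hve⟩; exact ⟨v, hv, h, hve⟩
    · rintro ⟨v, hv, h, hve⟩; exact ⟨h, v, hv, hve⟩
  rw [← Finset.card_filter_add_card_filter_not (s := G.edgeFinset) (fun e => ∀ v ∈ A, v ∉ e), h1,
    Finset.card_biUnion]
  · simp_rw [card_filter_mem_edgeFinset]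
  · intro u hu v hv huv
    rw [Function.onFun, Finset.disjoint_left]
    intro e he he'
    rw [Finset.mem_filter, mem_edgeFinset] at he he'
    have : e = s(u, v) := (Sym2.mem_and_mem_iff huv).1 ⟨he.2, he'.2⟩
    rw [this] at he
    exact hA hu hv huv he.1

/-- Colouring each `r`-matching by one of its edges avoiding `r - 1` independent vertices. -/
theorem colorable_generalKneserGraph_matchingGraph {r : ℕ} (hr : 1 ≤ r) {A : Finset V}
    (hA : A.card = r - 1) :
    (generalKneserGraph G (matchingGraph r)).Colorable
      (G.edgeFinset.filter fun e => ∀ v ∈ A, v ∉ e).card := by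
  have hex : ∀ K : {K : G.Subgraph // Nonempty (K.coe ≃g matchingGraph r)},
      ∃ e ∈ K.1.edgeSet, e ∈ G.edgeFinset.filter fun e => ∀ v ∈ A, v ∉ e := by
    rintro ⟨K, ⟨φ⟩⟩
    obtain ⟨M, hMK, hmatch, hcard⟩ := exists_isMatch_of_iso φ
    by_contra! hno
    have hmeet : ∀ e ∈ M, ∃ v ∈ A, v ∈ e := by
      intro e he
      have heK : e ∈ K.edgeSet := hMK ▸ he
      by_contra! h
      exact hno e heK (Finset.mem_filter.2 ⟨mem_edgeFinset.2 (K.edgeSet_subset heK), h⟩)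
    obtain ⟨e₀, he₀⟩ := Finset.card_pos.1 (show 0 < M.card by omega)
    have : Nonempty V := ⟨(hmeet e₀ he₀).choose⟩
    choose! g hgA hge using hmeet
    -- Disjoint edges meet `A` in different vertices, giving `r ≤ r - 1`.
    have := Finset.card_le_card_of_injOn g hgA fun e he f hf hef =>
      hmatch e he f hf (g e) (hge e he) (hef ▸ hge f hf)
    omega
  choose col hcol hcol' using hex
  let C : (generalKneserGraph G (matchingGraph r)).Coloring
      (G.edgeFinset.filter fun e => ∀ v ∈ A, v ∉ e) :=
    Coloring.mk (fun K => ⟨col K, hcol' K⟩) (by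
      rintro K L ⟨-, hd⟩ h
      have h' : col K = col L := congrArg Subtype.val h
      exact Set.disjoint_left.1 hd (hcol K) (h' ▸ hcol L))
  rw [← Fintype.card_coe]
  exact C.colorable

/-- A lower bound for the chromatic number carries over from matchings to copies of `rK₂`. -/
theorem exists_matching_coloring {r C : ℕ} (hr : 1 ≤ r)
    (hC : (generalKneserGraph G (matchingGraph r)).Colorable C) :
    ∃ c : Finset (Sym2 V) → ℕ,
      (∀ M ⊆ G.edgeFinset, IsMatch M → M.card = r → c M < C) ∧
      ∀ M ⊆ G.edgeFinset, IsMatch M → M.card = r → ∀ M' ⊆ G.edgeFinset, IsMatch M' →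
        M'.card = r → Disjoint M M' → c M ≠ c M' := by
  classical
  obtain ⟨col⟩ := hC
  have hex : ∀ M : Finset (Sym2 V), M ⊆ G.edgeFinset ∧ IsMatch M ∧ M.card = r →
      ∃ K : {K : G.Subgraph // Nonempty (K.coe ≃g matchingGraph r)}, K.1.edgeSet = M := by
    rintro M ⟨h1, h2, h3⟩
    obtain ⟨K, hK, hKM⟩ := exists_iso_of_isMatch (fun e he => mem_edgeFinset.1 (h1 he)) h2 h3
    exact ⟨⟨K, hK⟩, hKM⟩
  let c : Finset (Sym2 V) → ℕ := fun M =>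
    if h : M ⊆ G.edgeFinset ∧ IsMatch M ∧ M.card = r then (col (hex M h).choose).val else 0
  have hc : ∀ M (h : M ⊆ G.edgeFinset ∧ IsMatch M ∧ M.card = r),
      c M = (col (hex M h).choose).val := fun M h => dif_pos h
  refine ⟨c, fun M h1 h2 h3 => ?_, fun M h1 h2 h3 M' h1' h2' h3' hd => ?_⟩
  · rw [hc M ⟨h1, h2, h3⟩]; exact (col _).2
  · rw [hc M ⟨h1, h2, h3⟩, hc M' ⟨h1', h2', h3'⟩]
    intro heq
    have e1 := (hex M ⟨h1, h2, h3⟩).choose_spec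
    have e2 := (hex M' ⟨h1', h2', h3'⟩).choose_spec
    refine col.valid (v := (hex M ⟨h1, h2, h3⟩).choose) (w := (hex M' ⟨h1', h2', h3'⟩).choose)
      ⟨fun h => ?_, ?_⟩ (Fin.ext heq)
    -- Equal copies would make a matching disjoint from itself, hence empty, against `1 ≤ r`.
    · rw [h, e2] at e1
      have : M = M' := (Finset.coe_injective e1).symm
      subst this
      rw [disjoint_self, Finset.bot_eq_empty] at hd
      simp [hd] at h3; omega
    · rw [e1, e2]; exact_mod_cast hd

end SimpleGraph
-- Assembly of the two bounds.
/-- The vertices `v_1, …, v_n` are `v 0, …, v (n - 1)`, so `v_{r-1}` is `v ⟨r - 2, _⟩` and `v_r`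
is `v ⟨r - 1, _⟩`. The conclusion is the equality `χ(KG(G, rK₂)) = |E(G)| - ∑_{i ≤ r-1} deg v_i`,
written without a subtraction. -/
theorem mainTheorem1 {V : Type*} [Fintype V] [DecidableEq V]
    (G : SimpleGraph V) [DecidableRel G.Adj] (r n : ℕ) (g : ℕ∞)
    (hr : 2 ≤ r) (hrn : r - 1 ≤ n)
    (hconn : G.Connected) (hg : g ≤ G.oddGirth)
    (v : Fin n ≃ V) (hdeg : Antitone fun i : Fin n => G.degree (v i))
    (hmax : (r : ℝ≥0∞) ≤
      max ((g : ℝ≥0∞) / 2) (((G.degree (v ⟨r - 2, by omega⟩) : ℝ≥0∞) + 1) / 4))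
    (hindep : G.IsIndepSet (v '' {i : Fin n | i.val < r - 1}))
    (hparity : Even (G.degree (v ⟨r - 2, by omega⟩)) ∨
      ∃ h : r - 1 < n, G.degree (v ⟨r - 1, h⟩) < G.degree (v ⟨r - 2, by omega⟩)) :
    (generalKneserGraph G (matchingGraph r)).chromaticNumber
        + ((∑ i ∈ Finset.univ.filter (fun i : Fin n => i.val < r - 1), G.degree (v i) : ℕ) : ℕ∞)
      = (G.edgeFinset.card : ℕ∞) := by
  classical
  set D := G.degree (v ⟨r - 2, by omega⟩) with hD
  have hinj := v.injective
  let A : Finset V := (Finset.univ.filter fun i : Fin n => i.val < r - 1).map v.toEmbedding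
  have hmemA : ∀ i : Fin n, v i ∈ A ↔ i.val < r - 1 := by
    intro i
    simp [A]
  have hAcard : A.card = r - 1 := by
    rw [Finset.card_map, Fin.card_filter_val_lt, min_eq_right hrn]
  have hAsum : ∑ i ∈ Finset.univ.filter (fun i : Fin n => i.val < r - 1), G.degree (v i) =
      ∑ x ∈ A, G.degree x := by
    rw [Finset.sum_map]; rfl
  have hAindep : G.IsIndepSet (A : Set V) := by
    convert hindep using 1
    ext x
    simp [A]
  have hin : ∀ x ∈ A, D / 2 ≤ G.degree x / 2 := by
    intro x hx
    obtain ⟨i, rfl⟩ := v.surjective x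
    rw [hmemA] at hx
    exact Nat.div_le_div_right (hdeg (show i ≤ ⟨r - 2, by omega⟩ from by
      rw [Fin.le_def]; simp only; omega))
  -- Rounding up outside `A` against rounding down `D` is harmless when `D` is even or the degree
  -- drops strictly after `A`.
  have hout : ∀ x ∉ A, (G.degree x + 1) / 2 ≤ D / 2 := by
    intro x hx
    obtain ⟨i, rfl⟩ := v.surjective x
    rw [hmemA] at hx
    rcases hparity with heven | ⟨h, hlt⟩
    · have h1 : G.degree (v i) ≤ D := hdeg (show (⟨r - 2, by omega⟩ : Fin n) ≤ i from by
        rw [Fin.le_def]; simp only; omega)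
      rw [Nat.even_iff] at heven
      omega
    · have h1 : G.degree (v i) ≤ G.degree (v ⟨r - 1, h⟩) :=
        hdeg (show (⟨r - 1, h⟩ : Fin n) ≤ i from by rw [Fin.le_def]; simp only; omega)
      omega
  -- The second alternative is `4 * r ≤ D + 1` after rounding: `D ≥ 4 * r - 1` gives `D / 2 ≥ 2 * r
  -- - 1`.
  have hor : ((2 * r : ℕ) : ℕ∞) ≤ G.oddGirth ∨ 2 * (r - 1) + 1 ≤ D / 2 := by
    rcases le_max_iff.1 hmax with h | h
    · left
      refine le_trans ?_ hg
      rw [ENNReal.le_div_iff_mul_le (by simp) (by simp)] at h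
      have h2 : (((r * 2 : ℕ) : ℕ∞) : ℝ≥0∞) ≤ (g : ℝ≥0∞) := by
        push_cast; exact_mod_cast h
      rw [mul_comm]
      exact ENat.toENNReal_le.1 h2
    · right
      rw [ENNReal.le_div_iff_mul_le (by simp) (by simp)] at h
      have h2 : r * 4 ≤ D + 1 := by exact_mod_cast h
      omega
  have hcover : ∀ H ⊆ G.edgeFinset, (∀ M ⊆ H, IsMatch M → M.card ≠ r) →
      ∃ S : Finset V, S.card ≤ r - 1 ∧
        H.card ≤ ∑ v ∈ S, (H.filter fun e => v ∈ e).card + (r - 1 - S.card) * (D / 2) := by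
    intro H hH hM
    refine exists_cover_of_matchings_le H (r - 1) (D / 2)
      (fun e he => G.not_isDiag_of_mem_edgeFinset (hH he)) (fun M hMH hmatch => ?_) ?_
    · by_contra hlt
      obtain ⟨M', hM', hcard⟩ := Finset.exists_subset_card_eq (show r ≤ M.card by omega)
      exact hM M' (hM'.trans hMH) (hmatch.subset hM') hcard
    · rcases hor with h | h
      · exact Or.inr (G.exists_bicoloring_of_le_oddGirth r h H
          (fun e he => SimpleGraph.mem_edgeFinset.1 (hH he)) hM)
      · exact Or.inl h
  rw [hAsum]
  have hupper := SimpleGraph.colorable_generalKneserGraph_matchingGraph (G := G)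
    (show 1 ≤ r by omega) hAcard
  have hcount := SimpleGraph.card_filter_avoid_add_sum_degree hAindep
  apply le_antisymm
  · rw [← hcount, Nat.cast_add]
    exact add_le_add_left hupper.chromaticNumber_le _
  · obtain ⟨C, hC⟩ := ENat.ne_top_iff_exists.1
      (SimpleGraph.chromaticNumber_ne_top_iff_exists.2 ⟨_, hupper⟩)
    obtain ⟨c, hc1, hc2⟩ := SimpleGraph.exists_matching_coloring (show 1 ≤ r by omega)
      (SimpleGraph.chromaticNumber_le_iff_colorable.1 hC.symm.le)
    have := hconn.card_edgeFinset_le r (D / 2) C A hAcard hin hout hcover c hc1 hc2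
    rw [← hC, ← Nat.cast_add, Nat.cast_le]
    omega
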